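/- Let $n\ge 2$, let $s\in(0,1)\setminus\{\tfrac12\}$ and let $f=(f_1,\dots,f_n)$ be a vector field on $\mathbb{R}^n$ whose components are complex-valued Schwartz functions. For $x\in\mathbb{R}^n$ and $\xi\in\mathbb{S}^{n-1}$ let \[ (\chi_{s,1}f)(x,\xi)=\int_0^\infty t^{2s-1}\sum_{j=1}^n f_j(x+t\xi)\,\xi^j\,dt \] be the fractional divergent beam ray transform of $f$, and define its sphere averages \[ (\mathcal{A}^0_{1,s}f)(x)=c_{n,s}^{1,0}\int_{\mathbb{S}^{n-1}}(\chi_{s,1}f)(x,\xi)\,dS_\xi,\qquad (\mathcal{A}^{1,i}_{1,s}f)(x)=c_{n,s}^{1,1}\int_{\mathbb{S}^{n-1}}\xi^i(\chi_{s,1}f)(x,\xi)\,dS_\xi, \] where \[ c_{n,s}^{1,0}=\frac{-\Gamma\left(\frac{n+1-2s}{2}\right)}{2^{2s}\pi^{n/2}\,\Gamma\left(s+\frac12\right)},\qquad c_{n,s}^{1,1}=\frac{-\Gamma\left(\frac{n+2-2s}{2}\right)}{2^{2s-1}\pi^{n/2}\,\Gamma(s)} . \] Let \[ \mathbf{R}_i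 g(x)=\frac{\Gamma\left(\frac{n+1}{2}\right)}{\pi^{(n+1)/2}}\lim_{\epsilon\to0^+}\int_{\mathbb{R}^n\setminus B_\epsilon(x)}\frac{x_i-z_i}{|x-z|^{n+1}}\,g(z)\,dz \] be the $i$-th Riesz transform. For a tempered distribution $u$ whose Fourier transform $\widehat u$ (with $\widehat\varphi(y)=\int e^{-\mathrm{i}\langle x,y\rangle}\varphi(x)\,dx$) is a function such that $|y|^{2s}\widehat u$ is again a tempered distribution, let $(-\Delta)^s u$ be the inverse Fourier transform of $|y|^{2s}\widehat u(y)$. Then the integrals defining $\chi_{s,1}f$, $\mathcal{A}^0_{1,s}f$ and $\mathcal{A}^{1,i}_{1,s}f$ converge absolutely, the principal value defining $\mathbf{R}_i\mathcal{A}^0_{1,s}f(x)$ exists for every $x$, the function $-2s\,\mathbf{R}_i\mathcal{A}^0_{1,s}f-\mathcal{A}^{1,i}_{1,s}f$ is a tempered distribution in the domain of $(-\Delta)^s$ just described, and \[ f_i=(-\Delta)^s\left[-2s\,\mathbf{R}_i\mathcal{A}^0_{1,s}f-\mathcal{A}^{1,i}_{1,s}f\right],\qquad 1\le i\le n . \]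 -/

import Mathlib

open MeasureTheory Filter Topology Metric
open scoped SchwartzMap FourierTransform

noncomputable section

namespace DivergentBeam

/-- Fractional divergent beam ray transform of a Schwartz vector field `f = (f_j)`:
`χ_{s,1} f (x, ξ) = ∫₀^∞ t^{2s-1} ∑_j f_j(x + tξ) ξ^j dt`. -/
def chi {n : ℕ} (s : ℝ) (f : Fin n → 𝓢(EuclideanSpace ℝ (Fin n), ℂ))
    (x ξ : EuclideanSpace ℝ (Fin n)) : ℂ :=
  ∫ t in Set.Ioi (0 : ℝ), ((t ^ (2 * s - 1) : ℝ) : ℂ) * ∑ j, f j (x + t • ξ) * ((ξ j : ℝ) : ℂ)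

/-- The normalizing constant `c_{n,s}^{m,k}` of the sphere averages
(`(m + k) / 2` and `(m + k) % 2` are quotient and remainder of natural numbers). -/
def avgConst (n : ℕ) (s : ℝ) (m k : ℕ) : ℝ :=
  -Real.Gamma (((n : ℝ) + m + k - 2 * s) / 2) /
    ((2 : ℝ) ^ (2 * s - (((m + k) / 2 : ℕ) : ℝ)) * Real.pi ^ ((n : ℝ) / 2) *
      Real.Gamma (s + (((m + k) % 2 : ℕ) : ℝ) / 2))

/-- The average `A^0_{1,s} f`; `volume.toSphere` is the surface measure of the unit sphere. -/
def avgZero {n : ℕ} (s : ℝ) (f : Fin n → 𝓢(EuclideanSpace ℝ (Fin n), ℂ))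
    (x : EuclideanSpace ℝ (Fin n)) : ℂ :=
  (avgConst n s 1 0 : ℂ) *
    ∫ ξ : sphere (0 : EuclideanSpace ℝ (Fin n)) 1, chi s f x ξ
      ∂(volume : Measure (EuclideanSpace ℝ (Fin n))).toSphere

/-- The average `A^{1,i}_{1,s} f`. -/
def avgOne {n : ℕ} (s : ℝ) (f : Fin n → 𝓢(EuclideanSpace ℝ (Fin n), ℂ)) (i : Fin n)
    (x : EuclideanSpace ℝ (Fin n)) : ℂ :=
  (avgConst n s 1 1 : ℂ) *
    ∫ ξ : sphere (0 : EuclideanSpace ℝ (Fin n)) 1,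
      (((ξ : EuclideanSpace ℝ (Fin n)) i : ℝ) : ℂ) * chi s f x ξ
      ∂(volume : Measure (EuclideanSpace ℝ (Fin n))).toSphere

/-- The integrand `z ↦ (x_j - z_j) / |x - z|^{n+1} g(z)` of the `j`-th Riesz transform at `x`. -/
def rieszIntegrand {n : ℕ} (j : Fin n) (g : EuclideanSpace ℝ (Fin n) → ℂ)
    (x z : EuclideanSpace ℝ (Fin n)) : ℂ :=
  (((x j - z j) / ‖x - z‖ ^ (n + 1) : ℝ) : ℂ) * g z

/-- The truncated Riesz transform, over the complement of the ball of radius `ε` around `x`. -/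
def rieszTruncated {n : ℕ} (j : Fin n) (g : EuclideanSpace ℝ (Fin n) → ℂ)
    (x : EuclideanSpace ℝ (Fin n)) (ε : ℝ) : ℂ :=
  ((Real.Gamma (((n : ℝ) + 1) / 2) / Real.pi ^ (((n : ℝ) + 1) / 2) : ℝ) : ℂ) *
    ∫ z in (ball x ε)ᶜ, rieszIntegrand j g x z

/-- The Riesz transform `R_j g(x)`, as a principal value. -/
def rieszTransform {n : ℕ} (j : Fin n) (g : EuclideanSpace ℝ (Fin n) → ℂ)
    (x : EuclideanSpace ℝ (Fin n)) : ℂ :=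
  limUnder (𝓝[>] (0 : ℝ)) (rieszTruncated j g x)

/-- The principal value defining `R_j g(x)` exists: all truncated integrals converge absolutely
and they have a limit as the radius tends to `0`. -/
def RieszConverges {n : ℕ} (j : Fin n) (g : EuclideanSpace ℝ (Fin n) → ℂ)
    (x : EuclideanSpace ℝ (Fin n)) : Prop :=
  (∀ ε : ℝ, 0 < ε → IntegrableOn (rieszIntegrand j g x) (ball x ε)ᶜ) ∧
    Tendsto (rieszTruncated j g x) (𝓝[>] (0 : ℝ)) (𝓝 (rieszTransform j g x))

/-- The tempered distribution `T` is (integration against) the function `g`. -/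
def IsGivenBy {n : ℕ} (T : 𝓢'(EuclideanSpace ℝ (Fin n), ℂ))
    (g : EuclideanSpace ℝ (Fin n) → ℂ) : Prop :=
  ∀ φ : 𝓢(EuclideanSpace ℝ (Fin n), ℂ),
    Integrable (fun x => g x * φ x) ∧ T φ = ∫ x, g x * φ x

/-- `(-Δ)^s U = V` for tempered distributions: the Fourier transform of `U` is a function `g`,
its product `W` with the symbol of `(-Δ)^s` is a tempered distribution, and `V` is the inverse
Fourier transform of `W`. Mathlib's Fourier transform has the kernel `exp (-2πi⟨x, ξ⟩)`, so the
symbol is `(2π|ξ|)^{2s}`. -/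
def IsFracLaplacian {n : ℕ} (s : ℝ) (U V : 𝓢'(EuclideanSpace ℝ (Fin n), ℂ)) : Prop :=
  ∃ (g : EuclideanSpace ℝ (Fin n) → ℂ) (W : 𝓢'(EuclideanSpace ℝ (Fin n), ℂ)),
    IsGivenBy (𝓕 U) g ∧
    IsGivenBy W (fun ξ => (((2 * Real.pi * ‖ξ‖) ^ (2 * s) : ℝ) : ℂ) * g ξ) ∧
    V = 𝓕⁻ W

end DivergentBeam

end

namespace DivergentBeam

open scoped RealInnerProductSpace

/-! ### Powers of `r` as superpositions of Gaussians. -/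

section Subordination

/-! In polar coordinates the sphere averages become potentials of the `f_j`: up to constants, `A^0`
is the sum over `j` of `∫ y_j |y|^{-(n+1-2s)} f_j(x+y) dy`, and `A^{1,i}` is the sum of `∫ y_i y_j
|y|^{-(n+2-2s)} f_j(x+y) dy` (`integral_sphere_chi`, `integral_sphere_mul_chi`).

The Fourier transforms of these homogeneous kernels come from Gaussians. The Gamma integral writes
`|y|^{-2a}` as an integral over `t` of `exp(-πt|y|²)`; linear factors become derivatives of the
transformed Gaussian, and integrating over `t` again gives powers of `|ξ|`
(`integral_inner_kernel_mul_fourierInv`, `integral_inner_inner_kernel_mul_fourierInv`). With kernel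
`exp(-2πi⟨x,ξ⟩)` and the given normalizing constants, `A^0` has transform `-i (2π)^{-2s} ∑_j ξ_j
|ξ|^{-2s-1} f̂_j`, and `A^{1,i}` has transform `(2π)^{-2s} (2s ∑_j ξ_i ξ_j |ξ|^{-2s-2} f̂_j -
|ξ|^{-2s} f̂_i)`.

The Riesz transform multiplies by `-i ξ_i/|ξ|` (`tendsto_truncated_riesz`), so `-2s R_i A^0`
contributes exactly the term that cancels the double sum in `-A^{1,i}`. What is left is
`(2π|ξ|)^{-2s} f̂_i`, the Riesz potential of `f_i`, which `(-Δ)^s` inverts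
(`exists_isFracLaplacian`). Since `2s < n`, all these symbols are integrable, so every inverse
transform is an honest integral. The pointwise principal value needs in addition that `A^0` is
Lipschitz and decays like `|x|^{-(n-2s)}`. -/

theorem integral_rpow_mul_exp_neg_pi {a r : ℝ} (ha : 0 < a) (hr : 0 < r) :
    ∫ t in Set.Ioi (0 : ℝ), t ^ (a - 1) * Real.exp (-(Real.pi * t * r ^ 2)) =
      Real.Gamma a * Real.pi ^ (-a) * r ^ (-(2 * a)) := by
  have h := Real.integral_rpow_mul_exp_neg_mul_Ioi ha (r := Real.pi * r ^ 2) (by positivity)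
  have e : ∀ t : ℝ, Real.pi * t * r ^ 2 = Real.pi * r ^ 2 * t := fun t => by ring
  simp_rw [e, h]
  rw [one_div, Real.inv_rpow (by positivity), ← Real.rpow_neg (by positivity),
    Real.mul_rpow Real.pi_pos.le (by positivity), ← Real.rpow_natCast, ← Real.rpow_mul hr.le]
  push_cast
  rw [show (2 : ℝ) * -a = -(2 * a) by ring]
  ring

/-- The substitution `t ↦ 1/t` reduces this to the previous integral. It is the form needed on the
Fourier side, where the Gaussian of parameter `t` has become one of parameter `1/t`. -/
theorem integral_rpow_mul_exp_neg_pi_div {b r : ℝ} (hb : 0 < b) (hr : 0 < r) :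
    ∫ t in Set.Ioi (0 : ℝ), t ^ (-b - 1) * Real.exp (-(Real.pi * r ^ 2 / t)) =
      Real.Gamma b * Real.pi ^ (-b) * r ^ (-(2 * b)) := by
  rw [← integral_rpow_mul_exp_neg_pi hb hr, ← integral_comp_rpow_Ioi _ (p := -1) (by norm_num)]
  refine setIntegral_congr_fun measurableSet_Ioi fun t (ht : 0 < t) => ?_
  simp only [abs_neg, abs_one, one_mul, smul_eq_mul]
  rw [← mul_assoc, ← Real.rpow_mul ht.le, ← Real.rpow_add ht, Real.rpow_neg_one]
  congr 2
  · ring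
  · field_simp

theorem integrableOn_rpow_mul_exp_neg_pi {a r : ℝ} (ha : 0 < a) (hr : 0 < r) :
    IntegrableOn (fun t : ℝ => t ^ (a - 1) * Real.exp (-(Real.pi * t * r ^ 2))) (Set.Ioi 0) := by
  -- A non-integrable function has integral `0` by convention, so the nonzero value just computed
  -- forces integrability.
  refine Integrable.of_integral_ne_zero ?_
  rw [integral_rpow_mul_exp_neg_pi ha hr]
  have := Real.Gamma_pos_of_pos ha
  positivity

theorem integrableOn_rpow_mul_exp_neg_pi_div {b r : ℝ} (hb : 0 < b) (hr : 0 < r) :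
    IntegrableOn (fun t : ℝ => t ^ (-b - 1) * Real.exp (-(Real.pi * r ^ 2 / t))) (Set.Ioi 0) := by
  refine Integrable.of_integral_ne_zero ?_
  rw [integral_rpow_mul_exp_neg_pi_div hb hr]
  have := Real.Gamma_pos_of_pos hb
  positivity

variable {V : Type*} [MeasurableSpace V] {μ : Measure V} [SFinite μ]

/-- If `κ` is a superposition `∫ k t · dt` of nonnegative kernels and `κ * q` is integrable, then
so is `k t y * q y` as a function of `(t, y)`. -/
theorem integrable_prod_kernel_mul {k : ℝ → V → ℝ} {κ : V → ℝ} {q : V → ℂ}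
    (hk : Measurable (Function.uncurry k)) (hk0 : ∀ t > 0, ∀ y, 0 ≤ k t y)
    (hkint : ∀ᵐ y ∂μ, IntegrableOn (k · y) (Set.Ioi 0))
    (hκ : ∀ᵐ y ∂μ, ∫ t in Set.Ioi (0 : ℝ), k t y = κ y)
    (hq : AEStronglyMeasurable q μ) (hκq : Integrable (fun y => (κ y : ℂ) * q y) μ) :
    Integrable (fun p : ℝ × V => (k p.1 p.2 : ℂ) * q p.2)
      ((volume.restrict (Set.Ioi 0)).prod μ) := by
  refine (integrable_prod_iff' ?_).2 ⟨?_, ?_⟩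
  · exact (Complex.measurable_ofReal.comp hk).aestronglyMeasurable.mul hq.comp_snd
  · filter_upwards [hkint] with y hy
    exact hy.ofReal.mul_const _
  · refine hκq.norm.congr ?_
    filter_upwards [hκ] with y hy
    have e : ∫ t in Set.Ioi (0 : ℝ), ‖(k t y : ℂ) * q y‖ =
        ∫ t in Set.Ioi (0 : ℝ), k t y * ‖q y‖ := by
      refine setIntegral_congr_fun measurableSet_Ioi fun t ht => ?_
      simp [abs_of_nonneg (hk0 t ht y)]
    have h0 : 0 ≤ κ y := by
      rw [← hy]
      exact setIntegral_nonneg measurableSet_Ioi fun t ht => hk0 t ht y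
    simp only [e, integral_mul_const, hy]
    simp [abs_of_nonneg h0]

theorem integral_integral_kernel_mul {k : ℝ → V → ℝ} {κ : V → ℝ} {q : V → ℂ}
    (hk : Measurable (Function.uncurry k)) (hk0 : ∀ t > 0, ∀ y, 0 ≤ k t y)
    (hkint : ∀ᵐ y ∂μ, IntegrableOn (k · y) (Set.Ioi 0))
    (hκ : ∀ᵐ y ∂μ, ∫ t in Set.Ioi (0 : ℝ), k t y = κ y)
    (hq : AEStronglyMeasurable q μ) (hκq : Integrable (fun y => (κ y : ℂ) * q y) μ) :
    ∫ t in Set.Ioi (0 : ℝ), ∫ y, (k t y : ℂ) * q y ∂μ = ∫ y, (κ y : ℂ) * q y ∂μ := by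
  rw [integral_integral_swap (integrable_prod_kernel_mul hk hk0 hkint hκ hq hκq)]
  refine integral_congr_ae ?_
  filter_upwards [hκ] with y hy
  rw [integral_mul_const, ← hy, integral_complex_ofReal]

end Subordination

/-! ### Gaussians, their Fourier transforms, and superposition against a test function. -/

section GaussianKernels

/-- The Gaussian `exp (-π t |y|²)` as a complex valued function. -/
noncomputable def gaussian {V : Type*} [NormedAddCommGroup V] (t : ℝ) (y : V) : ℂ :=
  (Real.exp (-(Real.pi * t * ‖y‖ ^ 2)) : ℂ)

@[fun_prop]
theorem continuous_gaussian {V : Type*} [NormedAddCommGroup V] (t : ℝ) :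
    Continuous (gaussian t : V → ℂ) := by
  unfold gaussian; fun_prop

variable {V : Type*} [NormedAddCommGroup V] [InnerProductSpace ℝ V] [FiniteDimensional ℝ V]
  [MeasurableSpace V] [BorelSpace V]

theorem fourier_gaussian {t : ℝ} (ht : 0 < t) (w : V) :
    𝓕 (gaussian t : V → ℂ) w =
      ((t ^ (-(Module.finrank ℝ V : ℝ) / 2) * Real.exp (-(Real.pi * ‖w‖ ^ 2 / t)) : ℝ) : ℂ) := by
  have h := fourier_gaussian_innerProductSpace (V := V) (b := ((Real.pi * t : ℝ) : ℂ))
    (by simpa using by positivity) w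
  have e : (gaussian t : V → ℂ) = fun v => Complex.exp (-((Real.pi * t : ℝ) : ℂ) * ‖v‖ ^ 2) := by
    ext v
    simp [gaussian, ← Complex.ofReal_pow]
  rw [e, h, ← Complex.ofReal_div, div_mul_cancel_left₀ Real.pi_ne_zero,
    Complex.ofReal_mul (t ^ _), Complex.ofReal_exp]
  congr 1
  · rw [neg_div, Real.rpow_neg ht.le, ← Real.inv_rpow ht.le, Complex.ofReal_cpow (by positivity)]
    push_cast; rfl
  · congr 1
    push_cast
    have : (t : ℂ) ≠ 0 := by exact_mod_cast ht.ne'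
    have : (Real.pi : ℂ) ≠ 0 := by exact_mod_cast Real.pi_ne_zero
    field_simp

variable [Nontrivial V]

theorem integral_gaussian_superposition {a : ℝ} (ha : 0 < a) {q : V → ℂ}
    (hq : AEStronglyMeasurable q) (hi : Integrable fun y => ((‖y‖ ^ (-(2 * a)) : ℝ) : ℂ) * q y) :
    ∫ t in Set.Ioi (0 : ℝ),
        ∫ y, ((t ^ (a - 1) * Real.exp (-(Real.pi * t * ‖y‖ ^ 2)) : ℝ) : ℂ) * q y =
      ((Real.Gamma a * Real.pi ^ (-a) : ℝ) : ℂ) *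
        ∫ y, ((‖y‖ ^ (-(2 * a)) : ℝ) : ℂ) * q y := by
  rw [← integral_const_mul]
  simp_rw [← mul_assoc, ← Complex.ofReal_mul]
  refine integral_integral_kernel_mul (by fun_prop) (fun t ht y => by positivity) ?_ ?_ hq ?_
  -- The Gamma integral needs `y ≠ 0`; the origin is a null set because `V` is nontrivial.
  · filter_upwards [compl_mem_ae_iff.2 (measure_singleton (0 : V))] with y hy
    exact integrableOn_rpow_mul_exp_neg_pi ha (norm_pos_iff.2 hy)
  · filter_upwards [compl_mem_ae_iff.2 (measure_singleton (0 : V))] with y hy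
    exact integral_rpow_mul_exp_neg_pi ha (norm_pos_iff.2 hy)
  · simpa only [Complex.ofReal_mul, mul_assoc] using hi.const_mul
      ((Real.Gamma a * Real.pi ^ (-a) : ℝ) : ℂ)

/-- Fubini for the transformed Gaussians. Integrability in `t` is recorded too, because the
transform of the second order kernel is a difference of two such superpositions, to be combined
under one `t`-integral. -/
theorem integrable_dual_gaussian_superposition {b : ℝ} (hb : 0 < b) {q : V → ℂ}
    (hq : AEStronglyMeasurable q) (hi : Integrable fun y => ((‖y‖ ^ (-(2 * b)) : ℝ) : ℂ) * q y) :
    IntegrableOn (fun t : ℝ =>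
        ∫ y, ((t ^ (-b - 1) * Real.exp (-(Real.pi * ‖y‖ ^ 2 / t)) : ℝ) : ℂ) * q y)
      (Set.Ioi 0) ∧
    ∫ t in Set.Ioi (0 : ℝ),
        ∫ y, ((t ^ (-b - 1) * Real.exp (-(Real.pi * ‖y‖ ^ 2 / t)) : ℝ) : ℂ) * q y =
      ((Real.Gamma b * Real.pi ^ (-b) : ℝ) : ℂ) *
        ∫ y, ((‖y‖ ^ (-(2 * b)) : ℝ) : ℂ) * q y := by
  have hm : Measurable (Function.uncurry fun (t : ℝ) (y : V) =>
      t ^ (-b - 1) * Real.exp (-(Real.pi * ‖y‖ ^ 2 / t))) := by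
    unfold Function.uncurry; fun_prop
  have h0 : ∀ t > (0 : ℝ), ∀ y : V,
      0 ≤ t ^ (-b - 1) * Real.exp (-(Real.pi * ‖y‖ ^ 2 / t)) := fun t ht y => by positivity
  have h1 : ∀ᵐ y : V, IntegrableOn (fun t : ℝ =>
      t ^ (-b - 1) * Real.exp (-(Real.pi * ‖y‖ ^ 2 / t))) (Set.Ioi 0) := by
    filter_upwards [compl_mem_ae_iff.2 (measure_singleton (0 : V))] with y hy
    exact integrableOn_rpow_mul_exp_neg_pi_div hb (norm_pos_iff.2 hy)
  have h2 : ∀ᵐ y : V, ∫ t in Set.Ioi (0 : ℝ),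
      t ^ (-b - 1) * Real.exp (-(Real.pi * ‖y‖ ^ 2 / t)) =
        Real.Gamma b * Real.pi ^ (-b) * ‖y‖ ^ (-(2 * b)) := by
    filter_upwards [compl_mem_ae_iff.2 (measure_singleton (0 : V))] with y hy
    exact integral_rpow_mul_exp_neg_pi_div hb (norm_pos_iff.2 hy)
  have h3 : Integrable fun y : V =>
      ((Real.Gamma b * Real.pi ^ (-b) * ‖y‖ ^ (-(2 * b)) : ℝ) : ℂ) * q y := by
    simpa only [Complex.ofReal_mul, mul_assoc] using hi.const_mul
      ((Real.Gamma b * Real.pi ^ (-b) : ℝ) : ℂ)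
  refine ⟨(integrable_prod_kernel_mul hm h0 h1 h2 hq h3).integral_prod_left, ?_⟩
  rw [← integral_const_mul]
  simp_rw [← mul_assoc, ← Complex.ofReal_mul]
  exact integral_integral_kernel_mul hm h0 h1 h2 hq h3

theorem integrable_norm_pow_mul_gaussian (k : ℕ) {t : ℝ} (ht : 0 < t) :
    Integrable fun y : V => ‖y‖ ^ k * ‖gaussian t y‖ := by
  have h := integrable_fun_norm_addHaar (volume : Measure V)
    (f := fun r : ℝ => r ^ k * Real.exp (-(Real.pi * t * r ^ 2)))
  have h2 : Integrable fun y : V => ‖y‖ ^ k * Real.exp (-(Real.pi * t * ‖y‖ ^ 2)) := by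
    rw [h]
    refine (integrableOn_rpow_mul_exp_neg_mul_sq (b := Real.pi * t) (by positivity)
      (s := ((Module.finrank ℝ V - 1 + k : ℕ) : ℝ)) (by
        have : (0 : ℝ) ≤ ((Module.finrank ℝ V - 1 + k : ℕ) : ℝ) := by positivity
        linarith)).congr_fun (fun r hr => ?_) measurableSet_Ioi
    simp only [Real.rpow_natCast, smul_eq_mul, pow_add, neg_mul]
    ring
  refine h2.congr (.of_forall fun y => ?_)
  simp only [gaussian, Complex.norm_real, Real.norm_eq_abs, Real.abs_exp]

theorem integrable_gaussian {t : ℝ} (ht : 0 < t) : Integrable (gaussian t : V → ℂ) := by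
  rw [← integrable_norm_iff (continuous_gaussian t).aestronglyMeasurable]
  simpa using integrable_norm_pow_mul_gaussian (V := V) 0 ht

end GaussianKernels

/-! ### Fourier transforms of homogeneous kernels. -/

section HomogeneousKernels

theorem hasFDerivAt_exp_neg_norm_sq {V : Type*} [NormedAddCommGroup V] [InnerProductSpace ℝ V]
    (c : ℝ) (w : V) :
    HasFDerivAt (fun w : V => Real.exp (-(Real.pi * ‖w‖ ^ 2 / c)))
      ((-(2 * Real.pi / c) * Real.exp (-(Real.pi * ‖w‖ ^ 2 / c))) • innerSL ℝ w) w := by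
  have h := ((((hasStrictFDerivAt_norm_sq w).hasFDerivAt.const_mul Real.pi).mul_const c⁻¹).neg).exp
  refine (h.congr_fderiv ?_).congr_of_eventuallyEq (.of_forall fun y => ?_)
  · ext v
    simp [innerSL_apply_apply ℝ, div_eq_mul_inv]
    ring
  · simp [div_eq_mul_inv]

variable {V : Type*} [NormedAddCommGroup V] [InnerProductSpace ℝ V] [FiniteDimensional ℝ V]
  [MeasurableSpace V] [BorelSpace V]

theorem fourier_inner_mul {f : V → ℂ} (hf : Integrable f)
    (hvf : Integrable fun v => ‖v‖ * ‖f v‖) (u w : V) :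
    𝓕 (fun v => (⟪u, v⟫ : ℂ) * f v) w =
      Complex.I / (2 * Real.pi) * fderiv ℝ (𝓕 f) w u := by
  have hi : Integrable (VectorFourier.fourierSMulRight (innerSL ℝ) f) := by
    refine (hvf.const_mul (2 * Real.pi * ‖innerSL ℝ (E := V)‖)).mono'
      hf.1.fourierSMulRight (.of_forall fun v => ?_)
    rw [← mul_assoc]
    exact VectorFourier.norm_fourierSMulRight_le (innerSL ℝ) f v
  rw [(Real.hasFDerivAt_fourier hf hvf w).fderiv, Real.fourier_continuousLinearMap_apply hi,
    Real.fourier_eq', Real.fourier_eq', ← integral_const_mul]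
  refine integral_congr_ae (.of_forall fun v => ?_)
  simp only [VectorFourier.fourierSMulRight_apply, innerSL_apply_apply ℝ, smul_eq_mul,
    Complex.real_smul, real_inner_comm u v]
  have : (Real.pi : ℂ) ≠ 0 := by exact_mod_cast Real.pi_ne_zero
  field_simp
  rw [Complex.I_sq]
  ring

theorem fourier_inner_mul_gaussian [Nontrivial V] {t : ℝ} (ht : 0 < t) (u w : V) :
    𝓕 (fun y => (⟪u, y⟫ : ℂ) * gaussian t y) w = -Complex.I *
      ((t ^ (-(Module.finrank ℝ V : ℝ) / 2 - 1) * Real.exp (-(Real.pi * ‖w‖ ^ 2 / t)) : ℝ) : ℂ) *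
        ⟪u, w⟫ := by
  have hd : HasFDerivAt (fun w : V => ((t ^ (-(Module.finrank ℝ V : ℝ) / 2) *
      Real.exp (-(Real.pi * ‖w‖ ^ 2 / t)) : ℝ) : ℂ)) _ w :=
    Complex.ofRealCLM.hasFDerivAt.comp w ((hasFDerivAt_exp_neg_norm_sq t w).const_mul _)
  rw [fourier_inner_mul (integrable_gaussian ht)
    (by simpa using integrable_norm_pow_mul_gaussian (V := V) 1 ht),
    show 𝓕 (gaussian t : V → ℂ) = _ from funext (fourier_gaussian ht), hd.fderiv]
  simp only [ContinuousLinearMap.comp_apply, smul_apply, smul_eq_mul,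
    innerSL_apply_apply ℝ, Complex.ofRealCLM_apply, real_inner_comm u w, Real.rpow_sub_one ht.ne']
  have : (Real.pi : ℂ) ≠ 0 := by exact_mod_cast Real.pi_ne_zero
  push_cast
  field_simp

/-- Differentiate the first order formula once more. The product rule gives two terms: the
derivative of the linear factor, and that of the exponential, whose extra `t⁻¹` later turns the
exponent `b` into `b + 1`. -/
theorem fourier_inner_mul_inner_mul_gaussian [Nontrivial V] {t : ℝ} (ht : 0 < t) (u v w : V) :
    𝓕 (fun y => (⟪u, y⟫ : ℂ) * ((⟪v, y⟫ : ℂ) * gaussian t y)) w =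
      ((t ^ (-(Module.finrank ℝ V : ℝ) / 2 - 1) * Real.exp (-(Real.pi * ‖w‖ ^ 2 / t)) : ℝ) : ℂ) *
          (⟪u, v⟫ / (2 * Real.pi)) -
      ((t ^ (-(Module.finrank ℝ V : ℝ) / 2 - 2) * Real.exp (-(Real.pi * ‖w‖ ^ 2 / t)) : ℝ) : ℂ) *
        (⟪u, w⟫ * ⟪v, w⟫) := by
  have hd : HasFDerivAt (fun w : V => -Complex.I *
      ((t ^ (-(Module.finrank ℝ V : ℝ) / 2 - 1) * Real.exp (-(Real.pi * ‖w‖ ^ 2 / t)) : ℝ) : ℂ) *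
        ⟪v, w⟫) _ w :=
    ((Complex.ofRealCLM.hasFDerivAt.comp w
      ((hasFDerivAt_exp_neg_norm_sq t w).const_mul _)).const_mul (-Complex.I)).mul
      (Complex.ofRealCLM.hasFDerivAt.comp w (innerSL ℝ v).hasFDerivAt)
  rw [fourier_inner_mul _ _,
    show 𝓕 (fun y : V => (⟪v, y⟫ : ℂ) * gaussian t y) = _ from
      funext (fourier_inner_mul_gaussian ht v), hd.fderiv]
  · rw [show -(Module.finrank ℝ V : ℝ) / 2 - 2 = -(Module.finrank ℝ V : ℝ) / 2 - 1 - 1 by ring]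
    simp only [ContinuousLinearMap.comp_apply, smul_apply, smul_eq_mul,
      add_apply,
      innerSL_apply_apply ℝ, Complex.ofRealCLM_apply, real_inner_comm u w, real_inner_comm u v,
      Real.rpow_sub_one ht.ne', Function.comp_apply]
    have : (Real.pi : ℂ) ≠ 0 := by exact_mod_cast Real.pi_ne_zero
    have : (t : ℂ) ≠ 0 := by exact_mod_cast ht.ne'
    push_cast
    field_simp
    ring_nf
    simp only [Complex.I_sq]
    ring
  · refine ((integrable_norm_pow_mul_gaussian (V := V) 1 ht).const_mul ‖v‖).mono'
      (by fun_prop) (.of_forall fun y => ?_)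
    rw [norm_mul, Complex.norm_real, pow_one, ← mul_assoc]
    gcongr
    exact abs_real_inner_le_norm v y
  · refine ((integrable_norm_pow_mul_gaussian (V := V) 2 ht).const_mul ‖v‖).mono'
      (by fun_prop) (.of_forall fun y => ?_)
    rw [Real.norm_of_nonneg (by positivity), norm_mul, Complex.norm_real]
    calc ‖y‖ * (‖⟪v, y⟫‖ * ‖gaussian t y‖) ≤ ‖y‖ * ((‖v‖ * ‖y‖) * ‖gaussian t y‖) := by
          gcongr
          exact abs_real_inner_le_norm v y
      _ = _ := by ring

theorem continuous_fourierInv {h : V → ℂ} (hh : Integrable h) : Continuous (𝓕⁻ h) := by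
  rw [Real.fourierInv_eq_fourier_comp_neg]
  exact VectorFourier.fourierIntegral_continuous Real.continuous_fourierChar
    continuous_inner hh.comp_neg

/-- The multiplication formula for the Fourier transform, up to a reflection. -/
theorem integral_mul_fourierInv {q H : V → ℂ} (hq : Integrable q) (hH : Integrable H) :
    ∫ y, q y * 𝓕⁻ H y = ∫ ξ, 𝓕 q (-ξ) * H ξ := by
  have h := VectorFourier.integral_fourierIntegral_smul_eq_flip (L := innerₗ V)
    Real.continuous_fourierChar continuous_inner hH.comp_neg hq (μ := volume) (ν := volume)
  rw [Real.fourierInv_eq_fourier_comp_neg, ← integral_neg_eq_self (fun ξ => 𝓕 q (-ξ) * H ξ)]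
  simpa [mul_comm, Real.fourier_eq, VectorFourier.fourierIntegral] using! h

variable [Nontrivial V]

/-- The Fourier transform of the homogeneous kernel `⟪u, y⟫ |y|^{-2a}`, tested against the inverse
Fourier transform of an integrable function. -/
theorem integral_inner_kernel_mul_fourierInv {a b : ℝ} (ha : 0 < a) (hb : 0 < b)
    (hab : a + b = (Module.finrank ℝ V : ℝ) / 2 + 1) (u : V) {H : V → ℂ} (hH : Integrable H)
    (hk : Integrable fun y => ((‖y‖ ^ (-(2 * a)) : ℝ) : ℂ) * (⟪u, y⟫ * 𝓕⁻ H y))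
    (hm : Integrable fun ξ => ((‖ξ‖ ^ (-(2 * b)) : ℝ) : ℂ) * (⟪u, ξ⟫ * H ξ)) :
    ((Real.Gamma a * Real.pi ^ (-a) : ℝ) : ℂ) *
        ∫ y, ((‖y‖ ^ (-(2 * a)) : ℝ) : ℂ) * (⟪u, y⟫ * 𝓕⁻ H y) =
      Complex.I * (((Real.Gamma b * Real.pi ^ (-b) : ℝ) : ℂ) *
        ∫ ξ, ((‖ξ‖ ^ (-(2 * b)) : ℝ) : ℂ) * (⟪u, ξ⟫ * H ξ)) := by
  have hc : Continuous (𝓕⁻ H) := continuous_fourierInv hH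
  rw [← integral_gaussian_superposition ha (by fun_prop) hk,
    ← (integrable_dual_gaussian_superposition hb
      ((by fun_prop : AEStronglyMeasurable fun ξ : V => (⟪u, ξ⟫ : ℂ)).mul hH.1) hm).2,
    ← integral_const_mul]
  -- Both sides are now integrals over `t`, and they agree for each `t`: the Gaussian is integrable,
  -- so the multiplication formula applies.
  refine setIntegral_congr_fun measurableSet_Ioi fun t (ht : 0 < t) => ?_
  have hg : Integrable fun y : V => (⟪u, y⟫ : ℂ) * gaussian t y := by
    refine ((integrable_norm_pow_mul_gaussian (V := V) 1 ht).const_mul ‖u‖).mono'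
      (by fun_prop) (.of_forall fun y => ?_)
    rw [norm_mul, Complex.norm_real, pow_one, ← mul_assoc]
    gcongr
    exact abs_real_inner_le_norm u y
  have e := integral_mul_fourierInv hg hH
  have e1 : ∫ y : V, ((t ^ (a - 1) * Real.exp (-(Real.pi * t * ‖y‖ ^ 2)) : ℝ) : ℂ) *
      (⟪u, y⟫ * 𝓕⁻ H y) = ((t ^ (a - 1) : ℝ) : ℂ) *
        ∫ y : V, (⟪u, y⟫ : ℂ) * gaussian t y * 𝓕⁻ H y := by
    rw [← integral_const_mul]
    congr 1 with y
    simp only [gaussian]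
    push_cast
    ring
  rw [e1, e, ← integral_const_mul, ← integral_const_mul]
  congr 1 with ξ
  -- The relation `hab` is what matches the powers of `t`: `t^{a-1}` from the superposition times
  -- `t^{-d/2-1}` from the transform is `t^{-b-1}`.
  rw [fourier_inner_mul_gaussian ht, show -b - 1 = (a - 1) + (-(Module.finrank ℝ V : ℝ) / 2 - 1) by
    linarith, Real.rpow_add ht, inner_neg_right, norm_neg]
  push_cast
  ring

/-- The Fourier transform of the homogeneous kernel `⟪u, y⟫ ⟪v, y⟫ |y|^{-2a}`, tested against the
inverse Fourier transform of an integrable function. -/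
theorem integral_inner_inner_kernel_mul_fourierInv {a b : ℝ} (ha : 0 < a) (hb : 0 < b)
    (hab : a + b = (Module.finrank ℝ V : ℝ) / 2 + 1) (u v : V) {H : V → ℂ} (hH : Integrable H)
    (hk : Integrable fun y => ((‖y‖ ^ (-(2 * a)) : ℝ) : ℂ) * (⟪u, y⟫ * (⟪v, y⟫ * 𝓕⁻ H y)))
    (hm : Integrable fun ξ => ((‖ξ‖ ^ (-(2 * b)) : ℝ) : ℂ) * H ξ)
    (hm' : Integrable fun ξ => ((‖ξ‖ ^ (-(2 * (b + 1))) : ℝ) : ℂ) * (⟪u, ξ⟫ * (⟪v, ξ⟫ * H ξ))) :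
    ((Real.Gamma a * Real.pi ^ (-a) : ℝ) : ℂ) *
        ∫ y, ((‖y‖ ^ (-(2 * a)) : ℝ) : ℂ) * (⟪u, y⟫ * (⟪v, y⟫ * 𝓕⁻ H y)) =
      ⟪u, v⟫ / (2 * Real.pi) * (((Real.Gamma b * Real.pi ^ (-b) : ℝ) : ℂ) *
        ∫ ξ, ((‖ξ‖ ^ (-(2 * b)) : ℝ) : ℂ) * H ξ) -
      ((Real.Gamma (b + 1) * Real.pi ^ (-(b + 1)) : ℝ) : ℂ) *
        ∫ ξ, ((‖ξ‖ ^ (-(2 * (b + 1))) : ℝ) : ℂ) * (⟪u, ξ⟫ * (⟪v, ξ⟫ * H ξ)) := by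
  have hc : Continuous (𝓕⁻ H) := continuous_fourierInv hH
  have hu : ∀ u : V, AEStronglyMeasurable fun ξ : V => (⟪u, ξ⟫ : ℂ) := fun u => by fun_prop
  obtain ⟨i1, e1⟩ := integrable_dual_gaussian_superposition hb hH.1 hm
  obtain ⟨i2, e2⟩ := integrable_dual_gaussian_superposition (by linarith : 0 < b + 1)
    ((hu u).mul ((hu v).mul hH.1)) hm'
  rw [← integral_gaussian_superposition ha (by fun_prop) hk, ← e1]
  erw [← e2]
  rw [← integral_const_mul, ← integral_sub (i1.const_mul _) i2]
  refine setIntegral_congr_fun measurableSet_Ioi fun t (ht : 0 < t) => ?_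
  have hg : Integrable fun y : V => (⟪u, y⟫ : ℂ) * (⟪v, y⟫ * gaussian t y) := by
    refine ((integrable_norm_pow_mul_gaussian (V := V) 2 ht).const_mul (‖u‖ * ‖v‖)).mono'
      (by fun_prop) (.of_forall fun y => ?_)
    rw [norm_mul, norm_mul, Complex.norm_real, Complex.norm_real]
    calc ‖⟪u, y⟫‖ * (‖⟪v, y⟫‖ * ‖gaussian t y‖)
        ≤ (‖u‖ * ‖y‖) * ((‖v‖ * ‖y‖) * ‖gaussian t y‖) := by
          gcongr
          · exact abs_real_inner_le_norm u y
          · exact abs_real_inner_le_norm v y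
      _ = _ := by ring
  have e := integral_mul_fourierInv hg hH
  have e1 : ∫ y : V, ((t ^ (a - 1) * Real.exp (-(Real.pi * t * ‖y‖ ^ 2)) : ℝ) : ℂ) *
      (⟪u, y⟫ * (⟪v, y⟫ * 𝓕⁻ H y)) = ((t ^ (a - 1) : ℝ) : ℂ) *
        ∫ y : V, (⟪u, y⟫ : ℂ) * (⟪v, y⟫ * gaussian t y) * 𝓕⁻ H y := by
    rw [← integral_const_mul]
    congr 1 with y
    simp only [gaussian]
    push_cast
    ring
  have hE : ∀ ξ : V, ‖Real.exp (-(Real.pi * ‖ξ‖ ^ 2 / t))‖ ≤ 1 := fun ξ => by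
    rw [Real.norm_eq_abs, Real.abs_exp, Real.exp_le_one_iff]
    have := Real.pi_pos
    simp only [Left.neg_nonpos_iff]
    positivity
  have j1 : Integrable fun ξ : V => ((t ^ (-b - 1) *
      Real.exp (-(Real.pi * ‖ξ‖ ^ 2 / t)) : ℝ) : ℂ) * H ξ := by
    simp only [Complex.ofReal_mul, mul_assoc]
    refine (hH.bdd_mul (c := 1) (by fun_prop) (.of_forall fun ξ => ?_)).const_mul _
    rw [Complex.norm_real]
    exact hE ξ
  have j2 : Integrable fun ξ : V => ((t ^ (-(b + 1) - 1) *
      Real.exp (-(Real.pi * ‖ξ‖ ^ 2 / t)) : ℝ) : ℂ) * (⟪u, ξ⟫ * (⟪v, ξ⟫ * H ξ)) := by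
    refine (hH.bdd_mul (c := t ^ (-(b + 1) - 1) * (‖u‖ * ‖v‖ * (t / Real.pi)))
      (f := fun ξ : V => ((t ^ (-(b + 1) - 1) * Real.exp (-(Real.pi * ‖ξ‖ ^ 2 / t)) : ℝ) : ℂ) *
        (⟪u, ξ⟫ * ⟪v, ξ⟫)) (by fun_prop) (.of_forall fun ξ => ?_)).congr
      (.of_forall fun ξ => by simp only; ring)
    -- The constant `t / π` comes from `z ≤ exp z` at `z = π|ξ|²/t`.
    have hx : ‖ξ‖ ^ 2 * Real.exp (-(Real.pi * ‖ξ‖ ^ 2 / t)) ≤ t / Real.pi := by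
      have h := Real.add_one_le_exp (Real.pi * ‖ξ‖ ^ 2 / t)
      rw [Real.exp_neg, ← div_eq_mul_inv, div_le_iff₀ (Real.exp_pos _)]
      calc ‖ξ‖ ^ 2 = t / Real.pi * (Real.pi * ‖ξ‖ ^ 2 / t) := by
            have := Real.pi_ne_zero
            field_simp
        _ ≤ _ := by
            gcongr
            linarith
    rw [norm_mul, norm_mul, Complex.norm_real, Complex.norm_real, Complex.norm_real,
      Real.norm_of_nonneg (by positivity)]
    calc _ ≤ t ^ (-(b + 1) - 1) * Real.exp (-(Real.pi * ‖ξ‖ ^ 2 / t)) *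
          ((‖u‖ * ‖ξ‖) * (‖v‖ * ‖ξ‖)) := by
          gcongr
          · exact abs_real_inner_le_norm u ξ
          · exact abs_real_inner_le_norm v ξ
      _ = t ^ (-(b + 1) - 1) * (‖u‖ * ‖v‖ *
          (‖ξ‖ ^ 2 * Real.exp (-(Real.pi * ‖ξ‖ ^ 2 / t)))) := by ring
      _ ≤ _ := by gcongr
  simp only [Pi.mul_apply]
  rw [e1, e, ← integral_const_mul, ← integral_const_mul, ← integral_sub (j1.const_mul _) j2]
  congr 1 with ξ
  rw [fourier_inner_mul_inner_mul_gaussian ht,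
    show -b - 1 = (a - 1) + (-(Module.finrank ℝ V : ℝ) / 2 - 1) by linarith,
    show -(b + 1) - 1 = (a - 1) + (-(Module.finrank ℝ V : ℝ) / 2 - 2) by linarith,
    Real.rpow_add ht, Real.rpow_add ht, inner_neg_right, inner_neg_right, norm_neg]
  push_cast
  ring

end HomogeneousKernels

/-! ### Weighted estimates for powers of the norm. -/

section Estimates

variable {V : Type*} [NormedAddCommGroup V]

theorem one_add_norm_le_mul (x y : V) : 1 + ‖y‖ ≤ (1 + ‖x‖) * (1 + ‖x + y‖) := by
  have h : ‖y‖ ≤ ‖x + y‖ + ‖x‖ := by simpa using norm_sub_le (x + y) x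
  nlinarith [norm_nonneg x, norm_nonneg (x + y)]

/-- Peetre's inequality: a translation of the weight costs only a factor depending on the shift. -/
theorem one_add_norm_add_rpow_neg_le {r : ℝ} (hr : 0 ≤ r) (x y : V) :
    (1 + ‖x + y‖) ^ (-r) ≤ (1 + ‖x‖) ^ r * (1 + ‖y‖) ^ (-r) := by
  have h := Real.rpow_le_rpow (by positivity) (one_add_norm_le_mul x y) hr
  rw [Real.mul_rpow (by positivity) (by positivity)] at h
  rw [Real.rpow_neg (by positivity), Real.rpow_neg (by positivity), ← div_eq_mul_inv,
    le_div_iff₀ (by positivity), inv_mul_le_iff₀ (by positivity)]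
  linarith

theorem norm_rpow_le_of_one_le_norm {a : ℝ} (ha : a ≤ 0) {y : V} (hy : 1 ≤ ‖y‖) :
    ‖y‖ ^ a ≤ 2 ^ (-a) * (1 + ‖y‖) ^ a := by
  have h : ((1 + ‖y‖) / 2) ^ (-a) ≤ ‖y‖ ^ (-a) :=
    Real.rpow_le_rpow (by positivity) (by linarith) (by linarith)
  have hy0 : 0 < ‖y‖ := by linarith
  rw [Real.div_rpow (by positivity) (by positivity), div_le_iff₀ (by positivity),
    Real.rpow_neg (by positivity), Real.rpow_neg hy0.le, inv_mul_eq_div,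
    le_div_iff₀ (by positivity), inv_mul_le_iff₀ (by positivity)] at h
  linarith

variable [NormedSpace ℝ V] [FiniteDimensional ℝ V] [MeasurableSpace V] [BorelSpace V]
  [Nontrivial V] (μ : Measure V) [μ.IsAddHaarMeasure]

theorem integrableOn_ball_norm_rpow {a : ℝ} (ha : -(Module.finrank ℝ V : ℝ) < a) :
    IntegrableOn (fun y : V => ‖y‖ ^ a) (ball 0 1) μ := by
  rw [integrableOn_fun_norm_addHaar μ (f := fun r => r ^ a)]
  refine ((intervalIntegral.integrableOn_Ioo_rpow_iff zero_lt_one).2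
    (by linarith : -1 < ((Module.finrank ℝ V : ℝ) - 1 + a))).congr_fun (fun r hr => ?_)
    measurableSet_Ioo
  have h1 : 1 ≤ Module.finrank ℝ V := Module.finrank_pos
  simp only [smul_eq_mul]
  rw [Real.rpow_add hr.1, ← Real.rpow_natCast, Nat.cast_sub h1, Nat.cast_one]

theorem integrable_norm_rpow_mul_one_add_norm_rpow {a r : ℝ}
    (ha : -(Module.finrank ℝ V : ℝ) < a) (ha0 : a ≤ 0)
    (har : (Module.finrank ℝ V : ℝ) < r - a) :
    Integrable (fun y : V => ‖y‖ ^ a * (1 + ‖y‖) ^ (-r)) μ := by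
  have h1 := (integrableOn_ball_norm_rpow μ ha).integrable_indicator measurableSet_ball
  have h2 := (integrable_one_add_norm (μ := μ) har).const_mul (2 ^ (-a))
  refine (h1.add h2).mono' (by fun_prop) (.of_forall fun y => ?_)
  rw [Real.norm_of_nonneg (by positivity), Pi.add_apply]
  by_cases hy : ‖y‖ < 1
  · rw [Set.indicator_of_mem (by simpa using hy)]
    have : (1 + ‖y‖) ^ (-r) ≤ 1 :=
      Real.rpow_le_one_of_one_le_of_nonpos (by simp) (by linarith)
    have h3 : ‖y‖ ^ a * (1 + ‖y‖) ^ (-r) ≤ ‖y‖ ^ a := mul_le_of_le_one_right (by positivity) this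
    have h4 : 0 ≤ (2 : ℝ) ^ (-a) * (1 + ‖y‖) ^ (-(r - a)) := by positivity
    linarith
  · rw [Set.indicator_of_notMem (by simpa using hy), zero_add,
      show -(r - a) = a + -r by ring, Real.rpow_add (by positivity), ← mul_assoc]
    gcongr
    exact norm_rpow_le_of_one_le_norm ha0 (not_lt.1 hy)

theorem integrable_norm_rpow_mul_one_add_norm_add_rpow {a r : ℝ}
    (ha : -(Module.finrank ℝ V : ℝ) < a) (ha0 : a ≤ 0)
    (har : (Module.finrank ℝ V : ℝ) < r - a) (x : V) :
    Integrable (fun y : V => ‖y‖ ^ a * (1 + ‖x + y‖) ^ (-r)) μ := by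
  refine ((integrable_norm_rpow_mul_one_add_norm_rpow μ ha ha0 har).const_mul
    ((1 + ‖x‖) ^ r)).mono' (by fun_prop) (.of_forall fun y => ?_)
  rw [Real.norm_of_nonneg (by positivity), mul_left_comm]
  gcongr
  exact one_add_norm_add_rpow_neg_le (by linarith) x y

/-- Convolving a rapidly decaying function with the kernel `|y|^{-δ}` yields decay of order `δ`. -/
theorem exists_integral_norm_rpow_mul_le {δ r : ℝ} (hδ : 0 < δ)
    (hδ' : δ < Module.finrank ℝ V) (hr : Module.finrank ℝ V < r) :
    ∃ C, ∀ x : V, ∫ y, ‖y‖ ^ (-δ) * (1 + ‖x + y‖) ^ (-(r + δ)) ∂μ ≤ C * (1 + ‖x‖) ^ (-δ) := by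
  have hr0 : 0 < r := lt_of_le_of_lt (Nat.cast_nonneg _) hr
  have h1 := (integrableOn_ball_norm_rpow μ (neg_lt_neg hδ')).integrable_indicator measurableSet_ball
  have h2 := integrable_one_add_norm (μ := μ) hr
  refine ⟨∫ y, 2 ^ δ * (ball (0 : V) 1).indicator (fun y => ‖y‖ ^ (-δ)) y ∂μ +
    ∫ y, 2 ^ δ * (1 + ‖y‖) ^ (-r) ∂μ, fun x => ?_⟩
  have h3 : Integrable (fun y => 2 ^ δ * (1 + ‖x + y‖) ^ (-r)) μ :=
    (h2.comp_add_left x).const_mul _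
  rw [← integral_add_left_eq_self (fun y => 2 ^ δ * (1 + ‖y‖) ^ (-r)) x,
    ← integral_add (h1.const_mul _) h3, ← integral_mul_const]
  refine integral_mono
    (integrable_norm_rpow_mul_one_add_norm_add_rpow μ (neg_lt_neg hδ') (by linarith)
      (by linarith) x)
    (((h1.const_mul _).add h3).mul_const _) fun y => ?_
  -- Peetre with the roles of `x` and `y` exchanged extracts the decay in `x`, at the cost of
  -- `(1+|y|)^δ`. For `|y| < 1` this cost is at most `2^δ`; for `|y| ≥ 1` it is absorbed by
  -- `|y|^{-δ}`. The remaining weight of order `r` has an integral independent of `x`.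
  have key : (1 + ‖x + y‖) ^ (-δ) ≤ (1 + ‖y‖) ^ δ * (1 + ‖x‖) ^ (-δ) := by
    rw [add_comm x y]
    exact one_add_norm_add_rpow_neg_le hδ.le y x
  have e : (1 + ‖x + y‖) ^ (-(r + δ)) = (1 + ‖x + y‖) ^ (-r) * (1 + ‖x + y‖) ^ (-δ) := by
    rw [← Real.rpow_add (by positivity)]
    ring_nf
  have hle : (1 + ‖x + y‖) ^ (-r) ≤ 1 :=
    Real.rpow_le_one_of_one_le_of_nonpos (by simp) (by linarith)
  simp only [e]
  by_cases hy : ‖y‖ < 1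
  · rw [Set.indicator_of_mem (by simpa using hy)]
    have h4 : (1 + ‖y‖) ^ δ ≤ 2 ^ δ :=
      Real.rpow_le_rpow (by positivity) (by linarith) hδ.le
    calc ‖y‖ ^ (-δ) * ((1 + ‖x + y‖) ^ (-r) * (1 + ‖x + y‖) ^ (-δ))
        ≤ ‖y‖ ^ (-δ) * (1 * (2 ^ δ * (1 + ‖x‖) ^ (-δ))) := by
          gcongr
          exact key.trans (by gcongr)
      _ ≤ _ := by
          have : 0 ≤ (2 : ℝ) ^ δ * (1 + ‖x + y‖) ^ (-r) * (1 + ‖x‖) ^ (-δ) := by positivity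
          linarith
  · rw [Set.indicator_of_notMem (by simpa using hy), mul_zero, zero_add]
    have h4 := norm_rpow_le_of_one_le_norm (neg_nonpos.2 hδ.le) (not_lt.1 hy)
    rw [neg_neg] at h4
    have h5 : (1 + ‖y‖) ^ (-δ) * (1 + ‖y‖) ^ δ = 1 := by
      rw [← Real.rpow_add (by positivity), neg_add_cancel, Real.rpow_zero]
    calc ‖y‖ ^ (-δ) * ((1 + ‖x + y‖) ^ (-r) * (1 + ‖x + y‖) ^ (-δ))
        ≤ (2 ^ δ * (1 + ‖y‖) ^ (-δ)) *
          ((1 + ‖x + y‖) ^ (-r) * ((1 + ‖y‖) ^ δ * (1 + ‖x‖) ^ (-δ))) := by gcongr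
      _ = 2 ^ δ * (1 + ‖x + y‖) ^ (-r) * (1 + ‖x‖) ^ (-δ) *
          ((1 + ‖y‖) ^ (-δ) * (1 + ‖y‖) ^ δ) := by ring
      _ = _ := by rw [h5, mul_one]

end Estimates

theorem _root_.SchwartzMap.exists_norm_le_one_add_norm_rpow {V F : Type*} [NormedAddCommGroup V]
    [NormedSpace ℝ V] [NormedAddCommGroup F] [NormedSpace ℝ F] (f : 𝓢(V, F)) (r : ℝ) :
    ∃ C, 0 ≤ C ∧ ∀ x, ‖f x‖ ≤ C * (1 + ‖x‖) ^ (-r) := by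
  obtain ⟨k, hk⟩ := exists_nat_ge r
  refine ⟨2 ^ k * (Finset.Iic (k, 0)).sup (fun m => SchwartzMap.seminorm ℝ m.1 m.2) f,
    by positivity, fun x => ?_⟩
  have h := SchwartzMap.one_add_le_sup_seminorm_apply (𝕜 := ℝ) (m := (k, 0)) le_rfl le_rfl f x
  rw [norm_iteratedFDeriv_zero] at h
  have h2 : (1 + ‖x‖) ^ r ≤ (1 + ‖x‖) ^ k := by
    rw [← Real.rpow_natCast]
    exact Real.rpow_le_rpow_of_exponent_le (by simp) hk
  rw [Real.rpow_neg (by positivity), ← div_eq_mul_inv, le_div_iff₀ (by positivity), mul_comm]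
  exact (by gcongr : _ ≤ (1 + ‖x‖) ^ k * ‖f x‖).trans h

/-! ### Polar coordinates. -/

section Polar

variable {V : Type*} [NormedAddCommGroup V] [NormedSpace ℝ V] [FiniteDimensional ℝ V]
  [MeasurableSpace V] [BorelSpace V] [Nontrivial V] (μ : Measure V) [μ.IsAddHaarMeasure]

/-- Fubini after the measure preserving identification of `V \ {0}` with sphere times half-line. Its
first half yields the absolute convergence of the sphere averages. -/
theorem integrable_polar {F : V → ℂ} (hF : Integrable F μ) :
    Integrable (fun ξ : sphere (0 : V) 1 =>
      ∫ t in Set.Ioi (0 : ℝ), ((t ^ (Module.finrank ℝ V - 1) : ℝ) : ℂ) * F (t • (ξ : V)))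
      μ.toSphere ∧
    ∫ ξ : sphere (0 : V) 1, (∫ t in Set.Ioi (0 : ℝ),
      ((t ^ (Module.finrank ℝ V - 1) : ℝ) : ℂ) * F (t • (ξ : V))) ∂μ.toSphere = ∫ y, F y ∂μ := by
  set d := Module.finrank ℝ V
  let G : sphere (0 : V) 1 × Set.Ioi (0 : ℝ) → ℂ := fun p => F ((p.2 : ℝ) • (p.1 : V))
  have hG : G ∘ homeomorphUnitSphereProd V = fun y : ({0}ᶜ : Set V) => F y := by
    ext y
    have : ‖(y : V)‖ ≠ 0 := norm_ne_zero_iff.2 y.2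
    simp [G, smul_smul, mul_inv_cancel₀ this]
  have hGi : Integrable G (μ.toSphere.prod (Measure.volumeIoiPow (d - 1))) := by
    rw [← μ.measurePreserving_homeomorphUnitSphereProd.integrable_comp_emb
      (Homeomorph.measurableEmbedding _), hG]
    exact (integrableOn_iff_comap_subtypeVal (measurableSet_singleton _).compl).1 hF.integrableOn
  have hin : ∀ ξ : sphere (0 : V) 1, ∫ t, G (ξ, t) ∂(Measure.volumeIoiPow (d - 1)) =
      ∫ t in Set.Ioi (0 : ℝ), ((t ^ (d - 1) : ℝ) : ℂ) * F (t • (ξ : V)) := by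
    intro ξ
    simp only [Measure.volumeIoiPow, ENNReal.ofReal]
    rw [integral_withDensity_eq_integral_smul (by fun_prop),
      ← integral_subtype_comap measurableSet_Ioi
        fun t : ℝ => ((t ^ (d - 1) : ℝ) : ℂ) * F (t • (ξ : V))]
    refine integral_congr_ae (.of_forall fun t => ?_)
    have ht : (0 : ℝ) ≤ (t : ℝ) ^ (d - 1) := pow_nonneg (le_of_lt t.2) _
    simp [G, NNReal.smul_def, Real.coe_toNNReal _ ht]
  refine ⟨by simpa only [hin] using hGi.integral_prod_left, ?_⟩
  simp only [← hin]
  rw [← integral_prod G hGi, ← μ.measurePreserving_homeomorphUnitSphereProd.integral_comp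
    (Homeomorph.measurableEmbedding _)]
  change ∫ y, (G ∘ homeomorphUnitSphereProd V) y ∂_ = _
  rw [hG, integral_subtype_comap (measurableSet_singleton _).compl, restrict_compl_singleton]

end Polar

/-! ### Modulation and Lipschitz bounds for inverse Fourier transforms. -/

section FourierInv

variable {V : Type*} [NormedAddCommGroup V] [InnerProductSpace ℝ V] [FiniteDimensional ℝ V]
  [MeasurableSpace V] [BorelSpace V]

theorem fourierInv_eq_integral_mul (h : V → ℂ) (x : V) :
    𝓕⁻ h x = ∫ ξ, (Real.fourierChar ⟪ξ, x⟫ : ℂ) * h ξ := by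
  simp [Real.fourierInv_eq, Circle.smul_def]

theorem fourierInv_fourierChar_mul (h : V → ℂ) (x y : V) :
    𝓕⁻ (fun ξ => (Real.fourierChar ⟪ξ, x⟫ : ℂ) * h ξ) y = 𝓕⁻ h (x + y) := by
  simp only [fourierInv_eq_integral_mul, inner_add_right, AddChar.map_add_eq_mul, Circle.coe_mul]
  congr 1 with ξ
  ring

theorem integrable_fourierChar_mul {h : V → ℂ} (hh : Integrable h) (x : V) :
    Integrable fun ξ => (Real.fourierChar ⟪ξ, x⟫ : ℂ) * h ξ :=
  hh.bdd_mul (c := 1) (by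
    refine Continuous.aestronglyMeasurable ?_
    exact continuous_induced_dom.comp (Real.continuous_fourierChar.comp (by fun_prop)))
    (.of_forall fun ξ => (Circle.norm_coe _).le)

/-- Follows from `|exp(iθ) - 1| ≤ |θ|`. It supplies the regularity that makes the Riesz principal
value converge near the singularity. -/
theorem norm_fourierInv_sub_le {h : V → ℂ} (hh : Integrable h)
    (hh' : Integrable fun ξ => ‖ξ‖ * ‖h ξ‖) (x y : V) :
    ‖𝓕⁻ h x - 𝓕⁻ h y‖ ≤ (2 * Real.pi * ∫ ξ, ‖ξ‖ * ‖h ξ‖) * ‖x - y‖ := by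
  rw [fourierInv_eq_integral_mul, fourierInv_eq_integral_mul,
    ← integral_sub (integrable_fourierChar_mul hh x) (integrable_fourierChar_mul hh y),
    ← integral_const_mul, ← integral_mul_const]
  refine norm_integral_le_of_norm_le ((hh'.const_mul _).mul_const _) (.of_forall fun ξ => ?_)
  have e : (Real.fourierChar ⟪ξ, x⟫ : ℂ) * h ξ - (Real.fourierChar ⟪ξ, y⟫ : ℂ) * h ξ =
      (Real.fourierChar ⟪ξ, y⟫ : ℂ) *
        (Complex.exp (Complex.I * ((2 * Real.pi * ⟪ξ, x - y⟫ : ℝ) : ℂ)) - 1) * h ξ := by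
    have e2 : (Real.fourierChar ⟪ξ, x⟫ : ℂ) = (Real.fourierChar ⟪ξ, y⟫ : ℂ) *
        Complex.exp (Complex.I * ((2 * Real.pi * ⟪ξ, x - y⟫ : ℝ) : ℂ)) := by
      rw [Real.fourierChar_apply, Real.fourierChar_apply, ← Complex.exp_add, inner_sub_right]
      push_cast
      ring_nf
    rw [e2]
    ring
  rw [e, norm_mul, norm_mul, Circle.norm_coe, one_mul]
  calc _ ≤ ‖2 * Real.pi * ⟪ξ, x - y⟫‖ * ‖h ξ‖ := by
        gcongr
        exact Real.norm_exp_I_mul_ofReal_sub_one_le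
    _ ≤ 2 * Real.pi * (‖ξ‖ * ‖x - y‖) * ‖h ξ‖ := by
        rw [norm_mul, Real.norm_of_nonneg (by positivity : 0 ≤ 2 * Real.pi)]
        gcongr
        exact abs_real_inner_le_norm _ _
    _ = _ := by ring

end FourierInv

/-! ### The Riesz transform as a principal value and as a Fourier multiplier. -/

section RieszTransform

theorem norm_inner_kernel_le {V : Type*} [NormedAddCommGroup V] [InnerProductSpace ℝ V] {c : ℝ} (u y : V) :
    ‖((‖y‖ ^ (-(c + 1)) : ℝ) : ℂ) * (⟪u, y⟫ : ℂ)‖ ≤ ‖u‖ * ‖y‖ ^ (-c) := by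
  rcases eq_or_ne y 0 with rfl | hy
  · simp
    positivity
  have hy' : 0 < ‖y‖ := norm_pos_iff.2 hy
  rw [norm_mul, Complex.norm_real, Complex.norm_real, Real.norm_of_nonneg (by positivity)]
  calc ‖y‖ ^ (-(c + 1)) * ‖⟪u, y⟫‖ ≤ ‖y‖ ^ (-(c + 1)) * (‖u‖ * ‖y‖) := by
        gcongr
        exact abs_real_inner_le_norm u y
    _ = ‖u‖ * (‖y‖ ^ (-(c + 1)) * ‖y‖ ^ (1 : ℝ)) := by rw [Real.rpow_one]; ring
    _ = _ := by rw [← Real.rpow_add hy']; ring_nf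

variable {V : Type*} [NormedAddCommGroup V] [InnerProductSpace ℝ V] [FiniteDimensional ℝ V]
  [MeasurableSpace V] [BorelSpace V]

theorem integrableOn_compl_ball_inner_kernel_mul {g : V → ℂ} (hg : Continuous g) {C δ : ℝ}
    (hδ : 0 < δ) (hC : 0 ≤ C) (hgC : ∀ x, ‖g x‖ ≤ C * (1 + ‖x‖) ^ (-δ)) (u x : V)
    {ε : ℝ} (hε : 0 < ε) :
    IntegrableOn (fun y => ((‖y‖ ^ (-((Module.finrank ℝ V : ℝ) + 1)) : ℝ) : ℂ) * (⟪u, y⟫ : ℂ) *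
      g (x + y)) (ball 0 ε)ᶜ := by
  set d : ℝ := (Module.finrank ℝ V : ℝ)
  have hd : 0 ≤ d := Nat.cast_nonneg _
  have hi := (integrable_one_add_norm (E := V) (μ := volume)
    (by linarith : (Module.finrank ℝ V : ℝ) < d + δ)).const_mul
      (‖u‖ * (1 + ε⁻¹) ^ d * (C * (1 + ‖x‖) ^ δ))
  refine hi.integrableOn.mono' (by fun_prop) ?_
  filter_upwards [ae_restrict_mem measurableSet_ball.compl] with y hy
  have hy' : ε ≤ ‖y‖ := by simpa using hy
  have hy0 : 0 < ‖y‖ := hε.trans_le hy'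
  have h1 : ‖y‖ ^ (-d) ≤ (1 + ε⁻¹) ^ d * (1 + ‖y‖) ^ (-d) := by
    have h : 1 + ‖y‖ ≤ (1 + ε⁻¹) * ‖y‖ := by
      have : 1 ≤ ε⁻¹ * ‖y‖ := by rwa [← div_eq_inv_mul, one_le_div hε]
      linarith
    have h' := Real.rpow_le_rpow (by positivity) h hd
    rw [Real.mul_rpow (by positivity) (by positivity)] at h'
    rw [Real.rpow_neg (by positivity), Real.rpow_neg (by positivity), ← div_eq_mul_inv,
      le_div_iff₀ (by positivity), inv_mul_le_iff₀ (by positivity)]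
    linarith
  rw [norm_mul]
  calc _ ≤ (‖u‖ * ‖y‖ ^ (-d)) * (C * (1 + ‖x + y‖) ^ (-δ)) := by
        gcongr
        · exact norm_inner_kernel_le u y
        · exact hgC _
    _ ≤ (‖u‖ * ((1 + ε⁻¹) ^ d * (1 + ‖y‖) ^ (-d))) *
          (C * ((1 + ‖x‖) ^ δ * (1 + ‖y‖) ^ (-δ))) := by
        gcongr
        exact one_add_norm_add_rpow_neg_le hδ.le x y
    _ = ‖u‖ * (1 + ε⁻¹) ^ d * (C * (1 + ‖x‖) ^ δ) * ((1 + ‖y‖) ^ (-d) * (1 + ‖y‖) ^ (-δ)) := by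
        ring
    _ = _ := by rw [← Real.rpow_add (by positivity)]; ring_nf

variable [Nontrivial V]

/-- The kernel has the critical size `|y|^{-d}`. The symmetric difference gains a factor `|y|` near
the origin by the Lipschitz bound and `|y|^{-δ}` at infinity by decay. -/
theorem integrable_inner_kernel_mul_sub {g : V → ℂ} (hg : Continuous g) {C δ L : ℝ}
    (hδ : 0 < δ) (hC : 0 ≤ C) (hgC : ∀ x, ‖g x‖ ≤ C * (1 + ‖x‖) ^ (-δ)) (hL : 0 ≤ L)
    (hgL : ∀ x y, ‖g x - g y‖ ≤ L * ‖x - y‖) (u x : V) :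
    Integrable fun y => ((‖y‖ ^ (-((Module.finrank ℝ V : ℝ) + 1)) : ℝ) : ℂ) * (⟪u, y⟫ : ℂ) *
      (g (x - y) - g (x + y)) := by
  set d : ℝ := (Module.finrank ℝ V : ℝ) with hd
  have hd1 : 1 ≤ d := by
    rw [hd]
    exact_mod_cast (Module.finrank_pos : 0 < Module.finrank ℝ V)
  have hi := (integrable_norm_rpow_mul_one_add_norm_rpow (V := V) volume (a := 1 - d) (r := 1 + δ)
    (by linarith) (by linarith) (by linarith)).const_mul
      (‖u‖ * ((2 * L) * 2 ^ (1 + δ) + 2 * (2 * (C * (1 + ‖x‖) ^ δ))))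
  refine hi.mono' (by fun_prop) (.of_forall fun y => ?_)
  rcases eq_or_ne y 0 with rfl | hy
  · simp
    positivity
  have hy0 : 0 < ‖y‖ := norm_pos_iff.2 hy
  -- One bound for both regimes: the first summand of the constant serves `|y| < 1` (Lipschitz), the
  -- second `|y| ≥ 1` (decay).
  have h1 : ‖g (x - y) - g (x + y)‖ ≤
      ‖y‖ * (((2 * L) * 2 ^ (1 + δ) + 2 * (2 * (C * (1 + ‖x‖) ^ δ))) * (1 + ‖y‖) ^ (-(1 + δ))) := by
    rcases le_or_gt 1 ‖y‖ with h | h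
    · have hm := one_add_norm_add_rpow_neg_le hδ.le x (-y)
      have hp := one_add_norm_add_rpow_neg_le hδ.le x y
      rw [← sub_eq_add_neg, norm_neg] at hm
      have hb : ‖g (x - y) - g (x + y)‖ ≤ 2 * (C * (1 + ‖x‖) ^ δ) * (1 + ‖y‖) ^ (-δ) := by
        calc _ ≤ ‖g (x - y)‖ + ‖g (x + y)‖ := norm_sub_le _ _
          _ ≤ C * ((1 + ‖x‖) ^ δ * (1 + ‖y‖) ^ (-δ)) +
              C * ((1 + ‖x‖) ^ δ * (1 + ‖y‖) ^ (-δ)) := by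
            refine add_le_add ((hgC _).trans ?_) ((hgC _).trans ?_) <;> gcongr
          _ = _ := by ring
      have h2 : (1 + ‖y‖) ^ (-δ) ≤ 2 * ‖y‖ * (1 + ‖y‖) ^ (-(1 + δ)) := by
        rw [show -δ = 1 + -(1 + δ) by ring, Real.rpow_add (by positivity), Real.rpow_one]
        gcongr
        linarith
      refine hb.trans ?_
      calc _ ≤ 2 * (C * (1 + ‖x‖) ^ δ) * (2 * ‖y‖ * (1 + ‖y‖) ^ (-(1 + δ))) := by gcongr
        _ = ‖y‖ * ((0 + 2 * (2 * (C * (1 + ‖x‖) ^ δ))) * (1 + ‖y‖) ^ (-(1 + δ))) := by ring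
        _ ≤ _ := by
          gcongr
          positivity
    · have h2 : (1 : ℝ) ≤ 2 ^ (1 + δ) * (1 + ‖y‖) ^ (-(1 + δ)) := by
        rw [Real.rpow_neg (by positivity), ← div_eq_mul_inv, one_le_div (by positivity)]
        exact Real.rpow_le_rpow (by positivity) (by linarith) (by linarith)
      have h3 : ‖x - y - (x + y)‖ = 2 * ‖y‖ := by
        rw [show x - y - (x + y) = -((2 : ℝ) • y) by rw [two_smul]; abel, norm_neg, norm_smul]
        simp
      calc _ ≤ L * (2 * ‖y‖) := by simpa only [h3] using hgL (x - y) (x + y)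
        _ = L * (2 * ‖y‖) * 1 := by ring
        _ ≤ L * (2 * ‖y‖) * (2 ^ (1 + δ) * (1 + ‖y‖) ^ (-(1 + δ))) := by gcongr
        _ = ‖y‖ * (((2 * L) * 2 ^ (1 + δ) + 0) * (1 + ‖y‖) ^ (-(1 + δ))) := by ring
        _ ≤ _ := by
          gcongr
          positivity
  rw [norm_mul]
  calc _ ≤ (‖u‖ * ‖y‖ ^ (-d)) * (‖y‖ * (((2 * L) * 2 ^ (1 + δ) +
          2 * (2 * (C * (1 + ‖x‖) ^ δ))) * (1 + ‖y‖) ^ (-(1 + δ)))) := by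
        gcongr
        exact norm_inner_kernel_le u y
    _ = ‖u‖ * ((2 * L) * 2 ^ (1 + δ) + 2 * (2 * (C * (1 + ‖x‖) ^ δ))) *
          ((‖y‖ ^ (-d) * ‖y‖ ^ (1 : ℝ)) * (1 + ‖y‖) ^ (-(1 + δ))) := by rw [Real.rpow_one]; ring
    _ = _ := by rw [← Real.rpow_add hy0]; ring_nf

/-- The principal value of the convolution with the Riesz kernel `⟪u, y⟫ |y|^{-d-1}` acts on a
decaying inverse Fourier transform as multiplication by `-i ⟪u, ξ⟫ / |ξ|` on the Fourier side. -/
theorem tendsto_truncated_riesz {h : V → ℂ} (hh : Integrable h)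
    (hh' : Integrable fun ξ => ‖ξ‖ * ‖h ξ‖) {C δ : ℝ} (hδ : 0 < δ) (hC : 0 ≤ C)
    (hgC : ∀ x, ‖𝓕⁻ h x‖ ≤ C * (1 + ‖x‖) ^ (-δ)) (u x : V) :
    Tendsto (fun ε : ℝ => ((Real.Gamma (((Module.finrank ℝ V : ℝ) + 1) / 2) *
        Real.pi ^ (-(((Module.finrank ℝ V : ℝ) + 1) / 2)) : ℝ) : ℂ) *
      ∫ y in (ball 0 ε)ᶜ, ((‖y‖ ^ (-((Module.finrank ℝ V : ℝ) + 1)) : ℝ) : ℂ) * (⟪u, y⟫ : ℂ) *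
        𝓕⁻ h (x - y)) (𝓝[>] 0)
      (𝓝 (-Complex.I * 𝓕⁻ (fun ξ => ((‖ξ‖ ^ (-1 : ℝ) : ℝ) : ℂ) * (⟪u, ξ⟫ * h ξ)) x)) := by
  set d : ℝ := (Module.finrank ℝ V : ℝ) with hd
  set g := 𝓕⁻ h with hg
  set k : V → ℂ := fun y => ((‖y‖ ^ (-(d + 1)) : ℝ) : ℂ) * (⟪u, y⟫ : ℂ) with hk
  have hgc : Continuous g := continuous_fourierInv hh
  have hkneg : ∀ y, k (-y) = -k y := fun y => by simp [hk]
  have hD : Integrable fun y => k y * (g (x - y) - g (x + y)) :=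
    integrable_inner_kernel_mul_sub hgc hδ hC hgC (by positivity)
      (norm_fourierInv_sub_le hh hh') u x
  -- Since the kernel is odd, the truncated integral equals that of the symmetrized integrand, which
  -- is integrable on all of `V`. The limit `ε → 0` is then dominated convergence.
  have hsym : ∀ ε > 0, ∫ y in (ball 0 ε)ᶜ, k y * g (x - y) =
      ∫ y, (ball 0 ε)ᶜ.indicator (fun y => 2⁻¹ * (k y * (g (x - y) - g (x + y)))) y := by
    intro ε hε
    have i1 : IntegrableOn (fun y => k y * g (x + y)) (ball 0 ε)ᶜ :=
      integrableOn_compl_ball_inner_kernel_mul hgc hδ hC hgC u x hε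
    have hneg : ∀ F : V → ℂ, (fun y => (ball (0 : V) ε)ᶜ.indicator F (-y)) =
        (ball 0 ε)ᶜ.indicator fun y => F (-y) := by
      intro F
      ext y
      simp [Set.indicator]
    have e1 : (fun y => -(k y * g (x - y))) = fun y => k (-y) * g (x + -y) := by
      ext y
      rw [hkneg, sub_eq_add_neg]
      ring
    have i2 : IntegrableOn (fun y => -(k y * g (x - y))) (ball 0 ε)ᶜ := by
      rw [← integrable_indicator_iff measurableSet_ball.compl] at i1 ⊢
      rw [e1, ← hneg (fun y => k y * g (x + y))]
      exact i1.comp_neg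
    have e2 : ∫ y in (ball 0 ε)ᶜ, -(k y * g (x - y)) = ∫ y in (ball 0 ε)ᶜ, k y * g (x + y) := by
      rw [← integral_indicator measurableSet_ball.compl,
        ← integral_indicator measurableSet_ball.compl, e1, ← hneg (fun y => k y * g (x + y)),
        integral_neg_eq_self]
    rw [integral_indicator measurableSet_ball.compl, integral_const_mul]
    simp only [mul_sub]
    rw [integral_sub (by simpa [IntegrableOn] using i2.neg) i1, ← e2, integral_neg]
    ring
  have hlim : Tendsto (fun ε : ℝ => ∫ y in (ball 0 ε)ᶜ, k y * g (x - y)) (𝓝[>] 0)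
      (𝓝 (∫ y, 2⁻¹ * (k y * (g (x - y) - g (x + y))))) := by
    refine Tendsto.congr' (f₁ := fun ε => ∫ y, (ball 0 ε)ᶜ.indicator
      (fun y => 2⁻¹ * (k y * (g (x - y) - g (x + y)))) y) ?_ ?_
    · filter_upwards [self_mem_nhdsWithin] with ε hε using (hsym ε hε).symm
    refine tendsto_integral_filter_of_dominated_convergence _ (.of_forall fun ε =>
      (hD.const_mul 2⁻¹).1.indicator measurableSet_ball.compl)
      (.of_forall fun ε => .of_forall fun y => norm_indicator_le_norm_self _ _)
      (hD.const_mul 2⁻¹).norm ?_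
    filter_upwards [compl_mem_ae_iff.2 (measure_singleton (0 : V))] with y hy
    refine tendsto_const_nhds.congr' ?_
    filter_upwards [Ioo_mem_nhdsGT (norm_pos_iff.2 hy)] with ε hε
    rw [Set.indicator_of_mem]
    simpa using hε.2.le
  set E : V → ℂ := fun ξ => (Real.fourierChar ⟪ξ, x⟫ : ℂ) * h ξ with hE
  have hEi : Integrable E := integrable_fourierChar_mul hh x
  have hEF : ∀ y, 𝓕⁻ E y = g (x + y) := fourierInv_fourierChar_mul h x
  have hEn : ∀ y, 𝓕⁻ (fun ξ => E (-ξ)) y = g (x - y) := by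
    intro y
    rw [sub_eq_add_neg, ← hEF, fourierInv_eq_integral_mul, fourierInv_eq_integral_mul,
      ← integral_neg_eq_self fun ξ => (Real.fourierChar ⟪ξ, -y⟫ : ℂ) * E ξ]
    simp only [inner_neg_left, inner_neg_right, neg_neg]
  -- The kernel formula is used at the endpoint `2a = d + 1`, where the kernel is not locally
  -- integrable. This odd combination is chosen because its inverse transform is half the symmetric
  -- difference, which restores integrability.
  set H : V → ℂ := fun ξ => 2⁻¹ * (E (-ξ) - E ξ) with hH
  have hHi : Integrable H := (hEi.comp_neg.sub hEi).const_mul _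
  have hHF : ∀ y, 𝓕⁻ H y = 2⁻¹ * (g (x - y) - g (x + y)) := by
    intro y
    rw [← hEn, ← hEF, fourierInv_eq_integral_mul,
      fourierInv_eq_integral_mul, fourierInv_eq_integral_mul,
      ← integral_sub (integrable_fourierChar_mul hEi.comp_neg y) (integrable_fourierChar_mul hEi y),
      ← integral_const_mul]
    congr 1 with ξ
    simp only [hH]
    ring
  have hmE : Integrable fun ξ : V => ((‖ξ‖ ^ (-(2 * (1 / 2 : ℝ))) : ℝ) : ℂ) * (⟪u, ξ⟫ * E ξ) := by
    simp only [← mul_assoc]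
    refine hEi.bdd_mul (c := ‖u‖) (by fun_prop) (.of_forall fun ξ => ?_)
    have := norm_inner_kernel_le (c := 0) u ξ
    simpa using this
  have hT := integral_inner_kernel_mul_fourierInv (a := (d + 1) / 2) (b := 1 / 2)
    (by have : 0 ≤ d := Nat.cast_nonneg _
        linarith) (by norm_num) (by rw [← hd]; ring) u hHi
    (by
      refine (hD.const_mul 2⁻¹).congr (.of_forall fun y => ?_)
      simp only [hHF, hk, show -(2 * ((d + 1) / 2)) = -(d + 1) by ring]
      ring)
    (by
      refine ((hmE.comp_neg.neg.sub hmE).const_mul 2⁻¹).congr (.of_forall fun ξ => ?_)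
      simp [hH]
      ring)
  have hfin := hlim.const_mul ((Real.Gamma ((d + 1) / 2) * Real.pi ^ (-((d + 1) / 2)) : ℝ) : ℂ)
  convert hfin using 2
  have e3 : ∫ y, 2⁻¹ * (k y * (g (x - y) - g (x + y))) =
      ∫ y, ((‖y‖ ^ (-(2 * ((d + 1) / 2))) : ℝ) : ℂ) * (⟪u, y⟫ * 𝓕⁻ H y) := by
    congr 1 with y
    simp only [hHF, hk, show -(2 * ((d + 1) / 2)) = -(d + 1) by ring]
    ring
  -- The multiplier `⟪u, ξ⟫/|ξ|` is odd, so the two halves of `H` contribute equally.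
  have e4 : ∫ ξ, ((‖ξ‖ ^ (-(2 * (1 / 2 : ℝ))) : ℝ) : ℂ) * (⟪u, ξ⟫ * H ξ) =
      -∫ ξ, ((‖ξ‖ ^ (-(2 * (1 / 2 : ℝ))) : ℝ) : ℂ) * (⟪u, ξ⟫ * E ξ) := by
    have e5 := integral_neg_eq_self
      (fun ξ : V => ((‖ξ‖ ^ (-(2 * (1 / 2 : ℝ))) : ℝ) : ℂ) * (⟪u, ξ⟫ * E ξ)) volume
    have e6 : ∫ ξ, ((‖ξ‖ ^ (-(2 * (1 / 2 : ℝ))) : ℝ) : ℂ) * (⟪u, ξ⟫ * H ξ) =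
        ∫ ξ, 2⁻¹ * (-(((‖-ξ‖ ^ (-(2 * (1 / 2 : ℝ))) : ℝ) : ℂ) * (⟪u, -ξ⟫ * E (-ξ))) -
          ((‖ξ‖ ^ (-(2 * (1 / 2 : ℝ))) : ℝ) : ℂ) * (⟪u, ξ⟫ * E ξ)) := by
      congr 1 with ξ
      simp [hH]
      ring
    rw [e6, integral_const_mul, integral_sub (by simpa using hmE.comp_neg.neg) hmE,
      integral_neg, e5]
    ring
  -- With `b = 1/2` the Fourier side constant is `1`, so the normalized Riesz kernel has multiplier
  -- exactly `-i⟪u, ξ⟫/|ξ|`.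
  have hc : Real.Gamma (1 / 2) * Real.pi ^ (-(1 / 2) : ℝ) = 1 := by
    rw [Real.Gamma_one_half_eq, Real.sqrt_eq_rpow, ← Real.rpow_add Real.pi_pos]
    simp
  rw [e3, hT, e4, hc, fourierInv_eq_integral_mul]
  simp only [Complex.ofReal_one, one_mul, mul_neg, neg_mul, neg_inj]
  congr 2 with ξ
  simp [hE]
  ring

end RieszTransform

/-! ### Potentials of Schwartz functions and their Fourier symbols. -/

section Potentials

theorem norm_inner_inner_kernel_le {V : Type*} [NormedAddCommGroup V] [InnerProductSpace ℝ V]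
    {c : ℝ} (u v y : V) :
    ‖((‖y‖ ^ (-(c + 2)) : ℝ) : ℂ) * ((⟪u, y⟫ : ℂ) * (⟪v, y⟫ : ℂ))‖ ≤ ‖u‖ * ‖v‖ * ‖y‖ ^ (-c) := by
  rcases eq_or_ne y 0 with rfl | hy
  · simp
    positivity
  have hy' : 0 < ‖y‖ := norm_pos_iff.2 hy
  rw [norm_mul, norm_mul, Complex.norm_real, Complex.norm_real, Complex.norm_real,
    Real.norm_of_nonneg (by positivity)]
  calc _ ≤ ‖y‖ ^ (-(c + 2)) * ((‖u‖ * ‖y‖) * (‖v‖ * ‖y‖)) := by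
        gcongr
        · exact abs_real_inner_le_norm u y
        · exact abs_real_inner_le_norm v y
    _ = ‖u‖ * ‖v‖ * (‖y‖ ^ (-(c + 2)) * ‖y‖ ^ (2 : ℝ)) := by rw [Real.rpow_two]; ring
    _ = _ := by rw [← Real.rpow_add hy']; ring_nf

variable {V : Type*} [NormedAddCommGroup V] [InnerProductSpace ℝ V] [FiniteDimensional ℝ V]
  [MeasurableSpace V] [BorelSpace V]

theorem fourierInv_fourierChar_mul_fourier (f : 𝓢(V, ℂ)) (x y : V) :
    𝓕⁻ (fun ξ => (Real.fourierChar ⟪ξ, x⟫ : ℂ) * 𝓕 f ξ) y = f (x + y) := by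
  rw [fourierInv_fourierChar_mul, ← SchwartzMap.fourierInv_coe,
    FourierTransform.fourierInv_fourier_eq]

variable [Nontrivial V]

/-- A kernel of size `|y|^{-c}` with `0 ≤ c < d` can be integrated against Schwartz functions. -/
theorem integrable_kernel_mul_schwartz {c B : ℝ} (hc : 0 ≤ c) (hcd : c < Module.finrank ℝ V)
    {K : V → ℂ} (hK : AEStronglyMeasurable K) (hKB : ∀ y, ‖K y‖ ≤ B * ‖y‖ ^ (-c))
    (f : 𝓢(V, ℂ)) (x : V) : Integrable fun y => K y * f (x + y) := by
  have hd : (0 : ℝ) ≤ Module.finrank ℝ V := Nat.cast_nonneg _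
  obtain ⟨C, hC, hf⟩ := f.exists_norm_le_one_add_norm_rpow (Module.finrank ℝ V + 1)
  refine ((integrable_norm_rpow_mul_one_add_norm_add_rpow (V := V) volume (a := -c)
    (r := Module.finrank ℝ V + 1) (by linarith) (by linarith) (by linarith) x).const_mul
      (B * C)).mono' (hK.mul (f.continuous.comp (by fun_prop)).aestronglyMeasurable)
      (.of_forall fun y => ?_)
  rw [norm_mul]
  calc _ ≤ (B * ‖y‖ ^ (-c)) * (C * (1 + ‖x + y‖) ^ (-((Module.finrank ℝ V : ℝ) + 1))) :=
        mul_le_mul (hKB y) (hf _) (norm_nonneg _) ((norm_nonneg _).trans (hKB y))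
    _ = _ := by ring

theorem exists_norm_integral_kernel_mul_schwartz_le {c B : ℝ} (hc : 0 < c)
    (hcd : c < Module.finrank ℝ V) {K : V → ℂ} (hKB : ∀ y, ‖K y‖ ≤ B * ‖y‖ ^ (-c))
    (f : 𝓢(V, ℂ)) :
    ∃ C, ∀ x, ‖∫ y, K y * f (x + y)‖ ≤ C * (1 + ‖x‖) ^ (-c) := by
  obtain ⟨C, hC, hf⟩ := f.exists_norm_le_one_add_norm_rpow (Module.finrank ℝ V + 1 + c)
  obtain ⟨D, hD⟩ := exists_integral_norm_rpow_mul_le (V := V) volume hc hcd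
    (r := Module.finrank ℝ V + 1) (by linarith)
  have hB : 0 ≤ B := by
    obtain ⟨y, hy⟩ := exists_ne (0 : V)
    have hy' : 0 < ‖y‖ := norm_pos_iff.2 hy
    have := (norm_nonneg _).trans (hKB y)
    exact nonneg_of_mul_nonneg_left this (by positivity)
  refine ⟨B * C * D, fun x => ?_⟩
  have hd : (0 : ℝ) ≤ Module.finrank ℝ V := Nat.cast_nonneg _
  have hi := (integrable_norm_rpow_mul_one_add_norm_add_rpow (V := V) volume (a := -c)
    (r := Module.finrank ℝ V + 1 + c) (by linarith) (by linarith) (by linarith) x).const_mul (B * C)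
  refine (norm_integral_le_of_norm_le hi (.of_forall fun y => ?_)).trans ?_
  · rw [norm_mul]
    calc _ ≤ (B * ‖y‖ ^ (-c)) * (C * (1 + ‖x + y‖) ^ (-((Module.finrank ℝ V : ℝ) + 1 + c))) :=
          mul_le_mul (hKB y) (hf _) (norm_nonneg _) ((norm_nonneg _).trans (hKB y))
      _ = _ := by ring
  · rw [integral_const_mul, mul_assoc (B * C)]
    exact mul_le_mul_of_nonneg_left (hD x) (by positivity)

/-- The Fourier side of the Riesz potential of order `2s`, up to a constant. -/
noncomputable def symbolZero (s : ℝ) (f : 𝓢(V, ℂ)) (ξ : V) : ℂ :=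
  ((‖ξ‖ ^ (-(2 * s)) : ℝ) : ℂ) * 𝓕 f ξ

/-- The Fourier side of the convolution with `⟪u, y⟫ |y|^{2s-d-1}`, up to a constant. -/
noncomputable def symbolOne (s : ℝ) (u : V) (f : 𝓢(V, ℂ)) (ξ : V) : ℂ :=
  ((‖ξ‖ ^ (-(2 * (s + 1 / 2))) : ℝ) : ℂ) * (⟪u, ξ⟫ * 𝓕 f ξ)

/-- The Fourier side of the second order Riesz transform of the Riesz potential of order `2s`, up
to a constant. -/
noncomputable def symbolTwo (s : ℝ) (u v : V) (f : 𝓢(V, ℂ)) (ξ : V) : ℂ :=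
  ((‖ξ‖ ^ (-(2 * (s + 1))) : ℝ) : ℂ) * (⟪u, ξ⟫ * (⟪v, ξ⟫ * 𝓕 f ξ))

variable {s : ℝ}

theorem integrable_symbolZero (hs : 0 < s) (hsd : 2 * s < Module.finrank ℝ V) (f : 𝓢(V, ℂ)) :
    Integrable (symbolZero s f) := by
  refine (integrable_kernel_mul_schwartz (c := 2 * s) (B := 1)
    (K := fun ξ => ((‖ξ‖ ^ (-(2 * s)) : ℝ) : ℂ)) (by positivity) hsd
    (Measurable.aestronglyMeasurable (by fun_prop)) (fun y => ?_) (𝓕 f) (0 : V)).congr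
    (.of_forall fun ξ => by simp [symbolZero])
  rw [Complex.norm_real, Real.norm_of_nonneg (by positivity), one_mul]

theorem integrable_symbolOne (hs : 0 < s) (hsd : 2 * s < Module.finrank ℝ V) (u : V)
    (f : 𝓢(V, ℂ)) : Integrable (symbolOne s u f) := by
  refine (integrable_kernel_mul_schwartz (c := 2 * s) (B := ‖u‖)
    (K := fun ξ => ((‖ξ‖ ^ (-(2 * (s + 1 / 2))) : ℝ) : ℂ) * ⟪u, ξ⟫) (by positivity) hsd
    (by fun_prop) (fun y => ?_) (𝓕 f) (0 : V)).congr
    (.of_forall fun ξ => by simp [symbolOne, mul_assoc])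
  simpa only [show 2 * (s + 1 / 2) = 2 * s + 1 by ring] using norm_inner_kernel_le u y

theorem integrable_symbolTwo (hs : 0 < s) (hsd : 2 * s < Module.finrank ℝ V) (u v : V)
    (f : 𝓢(V, ℂ)) : Integrable (symbolTwo s u v f) := by
  refine (integrable_kernel_mul_schwartz (c := 2 * s) (B := ‖u‖ * ‖v‖)
    (K := fun ξ => ((‖ξ‖ ^ (-(2 * (s + 1))) : ℝ) : ℂ) * (⟪u, ξ⟫ * ⟪v, ξ⟫)) (by positivity) hsd
    (by fun_prop) (fun y => ?_) (𝓕 f) (0 : V)).congr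
    (.of_forall fun ξ => by simp [symbolTwo, mul_assoc])
  simpa only [show 2 * (s + 1) = 2 * s + 2 by ring] using norm_inner_inner_kernel_le u v y

/-- One spare power of decay of `𝓕 f` absorbs the factor `|ξ|`. This feeds the Lipschitz bound for
the zeroth average. -/
theorem integrable_norm_mul_symbolOne (hs : 0 < s) (hsd : 2 * s < Module.finrank ℝ V) (u : V)
    (f : 𝓢(V, ℂ)) : Integrable fun ξ => ‖ξ‖ * ‖symbolOne s u f ξ‖ := by
  have hd : (0 : ℝ) ≤ Module.finrank ℝ V := Nat.cast_nonneg _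
  obtain ⟨C, hC, hf⟩ := (𝓕 f).exists_norm_le_one_add_norm_rpow (Module.finrank ℝ V + 2)
  refine ((integrable_norm_rpow_mul_one_add_norm_rpow (V := V) volume (a := -(2 * s))
    (r := Module.finrank ℝ V + 1) (by linarith) (by linarith) (by linarith)).const_mul
      (‖u‖ * C)).mono'
    (continuous_norm.aestronglyMeasurable.mul (integrable_symbolOne hs hsd u f).1.norm)
    (.of_forall fun ξ => ?_)
  have hk := norm_inner_kernel_le (c := 2 * s) u ξ
  have e : ‖ξ‖ * (1 + ‖ξ‖) ^ (-((Module.finrank ℝ V : ℝ) + 2)) ≤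
      (1 + ‖ξ‖) ^ (-((Module.finrank ℝ V : ℝ) + 1)) := by
    rw [show -((Module.finrank ℝ V : ℝ) + 1) = 1 + -((Module.finrank ℝ V : ℝ) + 2) by ring,
      Real.rpow_add (by positivity), Real.rpow_one]
    gcongr
    linarith
  rw [Real.norm_of_nonneg (by positivity), symbolOne, ← mul_assoc, norm_mul,
    show 2 * (s + 1 / 2) = 2 * s + 1 by ring]
  calc _ ≤ ‖ξ‖ * ((‖u‖ * ‖ξ‖ ^ (-(2 * s))) *
          (C * (1 + ‖ξ‖) ^ (-((Module.finrank ℝ V : ℝ) + 2)))) := by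
        gcongr
        exact hf ξ
    _ = ‖u‖ * ‖ξ‖ ^ (-(2 * s)) * C *
          (‖ξ‖ * (1 + ‖ξ‖) ^ (-((Module.finrank ℝ V : ℝ) + 2))) := by ring
    _ ≤ ‖u‖ * ‖ξ‖ ^ (-(2 * s)) * C * (1 + ‖ξ‖) ^ (-((Module.finrank ℝ V : ℝ) + 1)) := by gcongr
    _ = _ := by ring

theorem integrable_inner_kernel_mul_schwartz (hs : 0 < s) (hsd : 2 * s < Module.finrank ℝ V)
    (u : V) (f : 𝓢(V, ℂ)) (x : V) :
    Integrable fun y => ((‖y‖ ^ (-((Module.finrank ℝ V : ℝ) + 1 - 2 * s)) : ℝ) : ℂ) *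
      (⟪u, y⟫ * f (x + y)) := by
  simp only [← mul_assoc]
  refine integrable_kernel_mul_schwartz (c := (Module.finrank ℝ V : ℝ) - 2 * s) (B := ‖u‖)
    (by linarith) (by linarith) (by fun_prop) (fun y => ?_) f x
  simpa only [sub_add_eq_add_sub] using
    norm_inner_kernel_le (c := (Module.finrank ℝ V : ℝ) - 2 * s) u y

theorem integrable_inner_inner_kernel_mul_schwartz (hs : 0 < s)
    (hsd : 2 * s < Module.finrank ℝ V) (u v : V) (f : 𝓢(V, ℂ)) (x : V) :
    Integrable fun y => ((‖y‖ ^ (-((Module.finrank ℝ V : ℝ) + 2 - 2 * s)) : ℝ) : ℂ) *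
      (⟪u, y⟫ * (⟪v, y⟫ * f (x + y))) := by
  have := integrable_kernel_mul_schwartz (c := (Module.finrank ℝ V : ℝ) - 2 * s) (B := ‖u‖ * ‖v‖)
    (K := fun y => ((‖y‖ ^ (-((Module.finrank ℝ V : ℝ) + 2 - 2 * s)) : ℝ) : ℂ) *
      (⟪u, y⟫ * ⟪v, y⟫))
    (by linarith) (by linarith) (by fun_prop) (fun y => by
      simpa only [sub_add_eq_add_sub] using
        norm_inner_inner_kernel_le (c := (Module.finrank ℝ V : ℝ) - 2 * s) u v y) f x
  simpa only [mul_assoc] using this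

theorem integral_inner_kernel_mul_schwartz (hs : 0 < s) (hsd : 2 * s < Module.finrank ℝ V)
    (u : V) (f : 𝓢(V, ℂ)) (x : V) :
    ((Real.Gamma (((Module.finrank ℝ V : ℝ) + 1 - 2 * s) / 2) *
        Real.pi ^ (-(((Module.finrank ℝ V : ℝ) + 1 - 2 * s) / 2)) : ℝ) : ℂ) *
      ∫ y, ((‖y‖ ^ (-((Module.finrank ℝ V : ℝ) + 1 - 2 * s)) : ℝ) : ℂ) * (⟪u, y⟫ * f (x + y)) =
    Complex.I * (((Real.Gamma (s + 1 / 2) * Real.pi ^ (-(s + 1 / 2)) : ℝ) : ℂ) *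
      𝓕⁻ (symbolOne s u f) x) := by
  -- The test function is `𝓕 f` modulated by the character of `x`, whose inverse transform is `y ↦ f
  -- (x + y)`.
  have h := integral_inner_kernel_mul_fourierInv
    (a := ((Module.finrank ℝ V : ℝ) + 1 - 2 * s) / 2) (b := s + 1 / 2) (by linarith) (by linarith)
    (by ring) u (H := fun ξ => (Real.fourierChar ⟪ξ, x⟫ : ℂ) * 𝓕 f ξ)
    (integrable_fourierChar_mul (𝓕 f).integrable x)
    (by simpa only [fourierInv_fourierChar_mul_fourier,
        mul_div_cancel₀ _ (two_ne_zero (α := ℝ))] using integrable_inner_kernel_mul_schwartz hs hsd u f x)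
    (by
      refine (integrable_fourierChar_mul (integrable_symbolOne hs hsd u f) x).congr
        (.of_forall fun ξ => ?_)
      simp only [symbolOne]
      ring)
  simp only [fourierInv_fourierChar_mul_fourier,
    show 2 * (((Module.finrank ℝ V : ℝ) + 1 - 2 * s) / 2) =
      (Module.finrank ℝ V : ℝ) + 1 - 2 * s by ring] at h
  rw [h, fourierInv_eq_integral_mul]
  congr 3 with ξ
  simp only [symbolOne]
  ring

theorem integral_inner_inner_kernel_mul_schwartz (hs : 0 < s)
    (hsd : 2 * s < Module.finrank ℝ V) (u v : V) (f : 𝓢(V, ℂ)) (x : V) :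
    ((Real.Gamma (((Module.finrank ℝ V : ℝ) + 2 - 2 * s) / 2) *
        Real.pi ^ (-(((Module.finrank ℝ V : ℝ) + 2 - 2 * s) / 2)) : ℝ) : ℂ) *
      ∫ y, ((‖y‖ ^ (-((Module.finrank ℝ V : ℝ) + 2 - 2 * s)) : ℝ) : ℂ) *
        (⟪u, y⟫ * (⟪v, y⟫ * f (x + y))) =
    ⟪u, v⟫ / (2 * Real.pi) * (((Real.Gamma s * Real.pi ^ (-s) : ℝ) : ℂ) *
      𝓕⁻ (symbolZero s f) x) -
    ((Real.Gamma (s + 1) * Real.pi ^ (-(s + 1)) : ℝ) : ℂ) * 𝓕⁻ (symbolTwo s u v f) x := by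
  have h := integral_inner_inner_kernel_mul_fourierInv
    (a := ((Module.finrank ℝ V : ℝ) + 2 - 2 * s) / 2) (b := s) (by linarith) hs
    (by ring) u v (H := fun ξ => (Real.fourierChar ⟪ξ, x⟫ : ℂ) * 𝓕 f ξ)
    (integrable_fourierChar_mul (𝓕 f).integrable x)
    (by simpa only [fourierInv_fourierChar_mul_fourier,
        mul_div_cancel₀ _ (two_ne_zero (α := ℝ))] using integrable_inner_inner_kernel_mul_schwartz hs hsd u v f x)
    (by
      refine (integrable_fourierChar_mul (integrable_symbolZero hs hsd f) x).congr
        (.of_forall fun ξ => ?_)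
      simp only [symbolZero]
      ring)
    (by
      refine (integrable_fourierChar_mul (integrable_symbolTwo hs hsd u v f) x).congr
        (.of_forall fun ξ => ?_)
      simp only [symbolTwo]
      ring)
  simp only [fourierInv_fourierChar_mul_fourier,
    show 2 * (((Module.finrank ℝ V : ℝ) + 2 - 2 * s) / 2) =
      (Module.finrank ℝ V : ℝ) + 2 - 2 * s by ring] at h
  rw [h, fourierInv_eq_integral_mul, fourierInv_eq_integral_mul]
  congr 1
  · congr 3 with ξ
    simp only [symbolZero]
    ring
  · congr 2 with ξ
    simp only [symbolTwo]
    ring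

end Potentials

/-! ### Tempered distributions and the fractional Laplacian of a Riesz potential. -/

section Distributions

variable {n : ℕ}

theorem isGivenBy_toTemperedDistribution {g : EuclideanSpace ℝ (Fin n) → ℂ} (hg : Integrable g) :
    IsGivenBy ((memLp_one_iff_integrable.2 hg).toLp g : 𝓢'(EuclideanSpace ℝ (Fin n), ℂ)) g := by
  intro φ
  constructor
  · obtain ⟨C, -, hC⟩ := φ.decay 0 0
    refine (hg.mul_bdd (c := C) φ.continuous.aestronglyMeasurable (.of_forall fun x => ?_))
    simpa using hC x
  · rw [Lp.toTemperedDistribution_apply]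
    refine integral_congr_ae ?_
    filter_upwards [(memLp_one_iff_integrable.2 hg).coeFn_toLp] with x hx
    rw [hx, smul_eq_mul, mul_comm]

/-- The inverse Fourier transform of an integrable function is a tempered distribution whose
Fourier transform is that function. -/
theorem exists_isGivenBy_fourierInv {g : EuclideanSpace ℝ (Fin n) → ℂ} (hg : Integrable g) :
    ∃ U : 𝓢'(EuclideanSpace ℝ (Fin n), ℂ), IsGivenBy U (𝓕⁻ g) ∧ IsGivenBy (𝓕 U) g := by
  refine ⟨𝓕⁻ ((memLp_one_iff_integrable.2 hg).toLp g : 𝓢'(EuclideanSpace ℝ (Fin n), ℂ)), ?_, ?_⟩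
  · intro φ
    constructor
    · refine φ.integrable.bdd_mul (c := ∫ ξ, ‖g ξ‖)
        (continuous_fourierInv hg).aestronglyMeasurable (.of_forall fun x => ?_)
      rw [fourierInv_eq_integral_mul]
      refine (norm_integral_le_integral_norm _).trans_eq ?_
      simp only [norm_mul, Circle.norm_coe, one_mul]
    · rw [TemperedDistribution.fourierInv_apply, (isGivenBy_toTemperedDistribution hg _).2]
      simp only [SchwartzMap.fourierInv_coe]
      rw [integral_mul_fourierInv hg φ.integrable]
      simp only [Real.fourierInv_eq_fourier_neg]
  · rw [FourierTransform.fourier_fourierInv_eq]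
    exact isGivenBy_toTemperedDistribution hg

theorem IsGivenBy.congr_ae {T : 𝓢'(EuclideanSpace ℝ (Fin n), ℂ)}
    {g g' : EuclideanSpace ℝ (Fin n) → ℂ} (h : IsGivenBy T g) (hg : g =ᵐ[volume] g') :
    IsGivenBy T g' := by
  intro φ
  have e : (fun x => g x * φ x) =ᵐ[volume] fun x => g' x * φ x := by
    filter_upwards [hg] with x hx
    rw [hx]
  exact ⟨(h φ).1.congr e, (h φ).2.trans (integral_congr_ae e)⟩

theorem isGivenBy_schwartz (f : 𝓢(EuclideanSpace ℝ (Fin n), ℂ)) :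
    IsGivenBy (SchwartzMap.toTemperedDistributionCLM (EuclideanSpace ℝ (Fin n)) ℂ volume f) f := by
  intro φ
  constructor
  · obtain ⟨C, -, hC⟩ := φ.decay 0 0
    refine (f.integrable.mul_bdd (c := C) φ.continuous.aestronglyMeasurable
      (.of_forall fun x => ?_))
    simpa using hC x
  · rw [SchwartzMap.toTemperedDistributionCLM_apply_apply volume]
    simp only [smul_eq_mul, mul_comm]

/-- The Riesz potential of a Schwartz function `f` is a tempered distribution `U` with
`(-Δ)^s U = f`. -/
theorem exists_isFracLaplacian [Nontrivial (EuclideanSpace ℝ (Fin n))] {s : ℝ} (hs : 0 < s)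
    (hsn : 2 * s < n) (f : 𝓢(EuclideanSpace ℝ (Fin n), ℂ)) :
    ∃ U : 𝓢'(EuclideanSpace ℝ (Fin n), ℂ),
      IsGivenBy U (fun x => (((2 * Real.pi) ^ (-(2 * s)) : ℝ) : ℂ) * 𝓕⁻ (symbolZero s f) x) ∧
      IsFracLaplacian s U
        (SchwartzMap.toTemperedDistributionCLM (EuclideanSpace ℝ (Fin n)) ℂ volume f) := by
  have hi := (integrable_symbolZero hs (by simpa using hsn) f).const_mul
    (((2 * Real.pi) ^ (-(2 * s)) : ℝ) : ℂ)
  obtain ⟨U, hU, hFU⟩ := exists_isGivenBy_fourierInv hi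
  refine ⟨U, ?_, _, SchwartzMap.toTemperedDistributionCLM _ ℂ volume (𝓕 f), hFU, ?_, ?_⟩
  · convert hU using 2 with x
    simp only [fourierInv_eq_integral_mul]
    rw [← integral_const_mul]
    congr 1 with ξ
    ring
  -- The symbol `(2π|ξ|)^{2s}` cancels `(2π)^{-2s}|ξ|^{-2s}` only off the origin, hence equality
  -- almost everywhere.
  · refine (isGivenBy_schwartz (𝓕 f)).congr_ae ?_
    filter_upwards [compl_mem_ae_iff.2 (measure_singleton (0 : EuclideanSpace ℝ (Fin n)))]
      with ξ hξ
    have hξ' : 0 < ‖ξ‖ := norm_pos_iff.2 hξ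
    rw [symbolZero, ← mul_assoc, ← mul_assoc, ← Complex.ofReal_mul, ← Complex.ofReal_mul,
      mul_assoc, ← Real.mul_rpow (by positivity) (by positivity), ← Real.rpow_add (by positivity)]
    simp
  · rw [TemperedDistribution.fourierInv_toTemperedDistributionCLM_eq,
      FourierTransform.fourierInv_fourier_eq]

end Distributions

/-! ### The normalizing constants. -/

section Constants

/-- The constant of the average is exactly what replaces the ratio of Gamma factors in the kernel
formula by `-(2π)^{-2s}`. -/
theorem avgConst_one_zero_mul {n : ℕ} {s : ℝ} (hs : 0 < s) :
    avgConst n s 1 0 * (Real.Gamma (s + 1 / 2) * Real.pi ^ (-(s + 1 / 2))) =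
      -(2 * Real.pi) ^ (-(2 * s)) * (Real.Gamma (((n : ℝ) + 1 - 2 * s) / 2) *
        Real.pi ^ (-(((n : ℝ) + 1 - 2 * s) / 2))) := by
  have hG : Real.Gamma (s + 1 / 2) ≠ 0 := (Real.Gamma_pos_of_pos (by linarith)).ne'
  have hp : Real.pi ^ (-(s + 1 / 2)) =
      Real.pi ^ (-(2 * s)) * Real.pi ^ (-(((n : ℝ) + 1 - 2 * s) / 2)) * Real.pi ^ ((n : ℝ) / 2) := by
    rw [← Real.rpow_add Real.pi_pos, ← Real.rpow_add Real.pi_pos]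
    ring_nf
  have h2 : (2 : ℝ) ^ (-(2 * s)) = ((2 : ℝ) ^ (2 * s))⁻¹ := Real.rpow_neg (by norm_num) _
  have h3 : (0 : ℝ) < 2 ^ (2 * s) := by positivity
  have h4 : 0 < Real.pi ^ ((n : ℝ) / 2) := Real.rpow_pos_of_pos Real.pi_pos _
  rw [Real.mul_rpow (by norm_num) Real.pi_pos.le, hp, h2]
  simp only [avgConst, add_zero, Nat.cast_one, Nat.cast_zero, Nat.reduceDiv, Nat.one_mod, sub_zero]
  field_simp

theorem avgConst_one_one_mul {n : ℕ} {s : ℝ} (hs : 0 < s) :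
    avgConst n s 1 1 * (Real.Gamma s * Real.pi ^ (-s) / (2 * Real.pi)) =
      -(2 * Real.pi) ^ (-(2 * s)) * (Real.Gamma (((n : ℝ) + 2 - 2 * s) / 2) *
        Real.pi ^ (-(((n : ℝ) + 2 - 2 * s) / 2))) := by
  have hG : Real.Gamma s ≠ 0 := (Real.Gamma_pos_of_pos hs).ne'
  have hp : Real.pi ^ (-s) = Real.pi ^ (-(2 * s)) * Real.pi ^ (-(((n : ℝ) + 2 - 2 * s) / 2)) *
      Real.pi ^ ((n : ℝ) / 2) * Real.pi := by
    rw [← Real.rpow_add Real.pi_pos, ← Real.rpow_add Real.pi_pos, ← Real.rpow_add_one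
      Real.pi_ne_zero]
    ring_nf
  have h2 : (2 : ℝ) ^ (-(2 * s)) = ((2 : ℝ) ^ (2 * s))⁻¹ := Real.rpow_neg (by norm_num) _
  have h3 : (0 : ℝ) < 2 ^ (2 * s) := by positivity
  have h4 : 0 < Real.pi ^ ((n : ℝ) / 2) := Real.rpow_pos_of_pos Real.pi_pos _
  have h5 := Real.pi_ne_zero
  have h6 : (n : ℝ) + 1 + 1 - 2 * s = n + 2 - 2 * s := by ring
  rw [Real.mul_rpow (by norm_num) Real.pi_pos.le, hp, h2]
  simp only [avgConst, Nat.reduceAdd, Nat.cast_one, Nat.cast_zero, Nat.reduceDiv, Nat.reduceMod,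
    zero_div, add_zero, h6, Real.rpow_sub_one (two_ne_zero (α := ℝ))]
  field_simp

/-- `Γ(s+1) = sΓ(s)` is the origin of the factor `2s` in the reconstruction formula. -/
theorem gamma_add_one_mul_pi_rpow {s : ℝ} (hs : 0 < s) :
    Real.Gamma (s + 1) * Real.pi ^ (-(s + 1)) =
      2 * s * (Real.Gamma s * Real.pi ^ (-s) / (2 * Real.pi)) := by
  have := Real.pi_ne_zero
  rw [Real.Gamma_add_one hs.ne', show -(s + 1) = -s - 1 by ring, Real.rpow_sub_one this]
  field_simp

end Constants

/-! ### The sphere averages as potentials and as inverse Fourier transforms. -/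

section Averages

variable {n : ℕ}

theorem inner_single_one (i : Fin n) (y : EuclideanSpace ℝ (Fin n)) :
    ⟪EuclideanSpace.single i (1 : ℝ), y⟫ = y i := by
  simp [EuclideanSpace.inner_single_left]

theorem fourierInv_sum_const_mul {ι : Type*} (t : Finset ι) (c : ι → ℂ)
    {h : ι → EuclideanSpace ℝ (Fin n) → ℂ} (hh : ∀ j, Integrable (h j))
    (x : EuclideanSpace ℝ (Fin n)) :
    𝓕⁻ (fun ξ => ∑ j ∈ t, c j * h j ξ) x = ∑ j ∈ t, c j * 𝓕⁻ (h j) x := by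
  simp only [fourierInv_eq_integral_mul, Finset.mul_sum, ← integral_const_mul]
  rw [integral_finsetSum _ fun j _ => integrable_fourierChar_mul ((hh j).const_mul (c j)) x]
  refine Finset.sum_congr rfl fun j _ => ?_
  congr 1 with ξ
  ring

variable {s : ℝ} (f : Fin n → 𝓢(EuclideanSpace ℝ (Fin n), ℂ))

theorem integrableOn_chi (hs : 0 < s) (hs1 : s < 1) (x : EuclideanSpace ℝ (Fin n))
    {ξ : EuclideanSpace ℝ (Fin n)} (hξ : ‖ξ‖ = 1) :
    IntegrableOn (fun t : ℝ => ((t ^ (2 * s - 1) : ℝ) : ℂ) *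
      ∑ j, f j (x + t • ξ) * ((ξ j : ℝ) : ℂ)) (Set.Ioi 0) := by
  simp only [Finset.mul_sum, ← mul_assoc]
  refine integrable_finsetSum _ fun j _ => Integrable.mul_const ?_ _
  -- Quadratic decay suffices: `2s - 1 > -1` at the origin, and `2s - 3 < -1` at infinity because `s
  -- < 1`.
  obtain ⟨C, hC, hf⟩ := (f j).exists_norm_le_one_add_norm_rpow 2
  have hm : Measurable fun t : ℝ => ((t ^ (2 * s - 1) : ℝ) : ℂ) * f j (x + t • ξ) := by
    have : Continuous fun t : ℝ => f j (x + t • ξ) := (f j).continuous.comp (by fun_prop)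
    fun_prop
  have hb : ∀ t > 0, ‖((t ^ (2 * s - 1) : ℝ) : ℂ) * f j (x + t • ξ)‖ ≤
      C * (1 + ‖x‖) ^ (2 : ℝ) * (t ^ (2 * s - 1) * (1 + t) ^ (-2 : ℝ)) := by
    intro t ht
    have h1 := one_add_norm_add_rpow_neg_le (by norm_num : (0 : ℝ) ≤ 2) x (t • ξ)
    rw [norm_smul, hξ, mul_one, Real.norm_of_nonneg ht.le] at h1
    rw [norm_mul, Complex.norm_real, Real.norm_of_nonneg (by positivity)]
    calc _ ≤ t ^ (2 * s - 1) * (C * ((1 + ‖x‖) ^ (2 : ℝ) * (1 + t) ^ (-2 : ℝ))) := by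
          gcongr
          exact (hf _).trans (by gcongr)
      _ = _ := by ring
  rw [← Set.Ioc_union_Ioi_eq_Ioi zero_le_one]
  refine IntegrableOn.union ?_ ?_
  · have hi : IntegrableOn (fun t : ℝ => t ^ (2 * s - 1)) (Set.Ioc 0 1) := by
      rw [← intervalIntegrable_iff_integrableOn_Ioc_of_le zero_le_one]
      exact intervalIntegral.intervalIntegrable_rpow' (by linarith)
    refine (hi.const_mul (C * (1 + ‖x‖) ^ (2 : ℝ))).mono' hm.aestronglyMeasurable ?_
    filter_upwards [ae_restrict_mem measurableSet_Ioc] with t ht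
    refine (hb t ht.1).trans ?_
    gcongr
    refine mul_le_of_le_one_right (Real.rpow_nonneg ht.1.le _) ?_
    exact Real.rpow_le_one_of_one_le_of_nonpos (by linarith [ht.1]) (by norm_num)
  · have hi : IntegrableOn (fun t : ℝ => t ^ (2 * s - 3)) (Set.Ioi 1) :=
      integrableOn_Ioi_rpow_of_lt (by linarith) zero_lt_one
    refine (hi.const_mul (C * (1 + ‖x‖) ^ (2 : ℝ))).mono' hm.aestronglyMeasurable ?_
    filter_upwards [ae_restrict_mem measurableSet_Ioi] with t ht
    have ht0 : (0 : ℝ) < t := zero_lt_one.trans ht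
    refine (hb t ht0).trans ?_
    rw [show 2 * s - 3 = (2 * s - 1) + -2 by ring, Real.rpow_add ht0]
    have h2 : (1 + t) ^ (-2 : ℝ) ≤ t ^ (-2 : ℝ) :=
      Real.rpow_le_rpow_of_nonpos ht0 (by linarith) (by norm_num)
    gcongr

variable [Nontrivial (EuclideanSpace ℝ (Fin n))]

/-- Polar coordinates: Jacobian, kernel and linear factor combine to `t^{n-1} t^{-(n+1-2s)} t =
t^{2s-1}`, the weight of the beam transform. -/
theorem integral_sphere_chi (hs : 0 < s) (hsn : 2 * s < n) (x : EuclideanSpace ℝ (Fin n)) :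
    Integrable (fun ξ : sphere (0 : EuclideanSpace ℝ (Fin n)) 1 => chi s f x ξ)
      (volume : Measure (EuclideanSpace ℝ (Fin n))).toSphere ∧
    ∫ ξ : sphere (0 : EuclideanSpace ℝ (Fin n)) 1, chi s f x ξ
        ∂(volume : Measure (EuclideanSpace ℝ (Fin n))).toSphere =
      ∑ j, ∫ y, ((‖y‖ ^ (-((n : ℝ) + 1 - 2 * s)) : ℝ) : ℂ) *
        (⟪EuclideanSpace.single j (1 : ℝ), y⟫ * f j (x + y)) := by
  have hi : ∀ j, Integrable fun y => ((‖y‖ ^ (-((n : ℝ) + 1 - 2 * s)) : ℝ) : ℂ) *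
      (⟪EuclideanSpace.single j (1 : ℝ), y⟫ * f j (x + y)) := fun j => by
    simpa using integrable_inner_kernel_mul_schwartz hs (by simpa using hsn)
      (EuclideanSpace.single j (1 : ℝ)) (f j) x
  have hn : 0 < n := by
    simpa using (Module.finrank_pos : 0 < Module.finrank ℝ (EuclideanSpace ℝ (Fin n)))
  have hp := integrable_polar volume (integrable_finsetSum Finset.univ fun j _ => hi j)
  have e : ∀ ξ : sphere (0 : EuclideanSpace ℝ (Fin n)) 1, ∫ t in Set.Ioi (0 : ℝ),
      ((t ^ (Module.finrank ℝ (EuclideanSpace ℝ (Fin n)) - 1) : ℝ) : ℂ) *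
        ∑ j, ((‖t • (ξ : EuclideanSpace ℝ (Fin n))‖ ^ (-((n : ℝ) + 1 - 2 * s)) : ℝ) : ℂ) *
        (⟪EuclideanSpace.single j (1 : ℝ), t • (ξ : EuclideanSpace ℝ (Fin n))⟫ *
          f j (x + t • (ξ : EuclideanSpace ℝ (Fin n)))) = chi s f x ξ := by
    intro ξ
    refine setIntegral_congr_fun measurableSet_Ioi fun t (ht : 0 < t) => ?_
    simp only [inner_smul_right, inner_single_one, norm_smul, norm_eq_of_mem_sphere, mul_one,
      Real.norm_of_nonneg ht.le, finrank_euclideanSpace_fin, Finset.mul_sum]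
    refine Finset.sum_congr rfl fun j _ => ?_
    have e1 : t ^ (2 * s - 1) = t ^ (n - 1) * t ^ (-((n : ℝ) + 1 - 2 * s)) * t := by
      rw [← Real.rpow_natCast, ← Real.rpow_add ht, ← Real.rpow_add_one ht.ne', Nat.cast_sub (Nat.one_le_iff_ne_zero.2 hn.ne')]
      push_cast
      ring_nf
    rw [e1]
    push_cast
    ring
  simp only [e] at hp
  refine ⟨hp.1, ?_⟩
  rw [hp.2, integral_finsetSum _ fun j _ => hi j]

theorem integral_sphere_mul_chi (hs : 0 < s) (hsn : 2 * s < n) (i : Fin n)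
    (x : EuclideanSpace ℝ (Fin n)) :
    Integrable (fun ξ : sphere (0 : EuclideanSpace ℝ (Fin n)) 1 =>
        (((ξ : EuclideanSpace ℝ (Fin n)) i : ℝ) : ℂ) * chi s f x ξ)
      (volume : Measure (EuclideanSpace ℝ (Fin n))).toSphere ∧
    ∫ ξ : sphere (0 : EuclideanSpace ℝ (Fin n)) 1,
        (((ξ : EuclideanSpace ℝ (Fin n)) i : ℝ) : ℂ) * chi s f x ξ
        ∂(volume : Measure (EuclideanSpace ℝ (Fin n))).toSphere =
      ∑ j, ∫ y, ((‖y‖ ^ (-((n : ℝ) + 2 - 2 * s)) : ℝ) : ℂ) *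
        (⟪EuclideanSpace.single i (1 : ℝ), y⟫ *
          (⟪EuclideanSpace.single j (1 : ℝ), y⟫ * f j (x + y))) := by
  have hi : ∀ j, Integrable fun y => ((‖y‖ ^ (-((n : ℝ) + 2 - 2 * s)) : ℝ) : ℂ) *
      (⟪EuclideanSpace.single i (1 : ℝ), y⟫ *
        (⟪EuclideanSpace.single j (1 : ℝ), y⟫ * f j (x + y))) := fun j => by
    simpa using integrable_inner_inner_kernel_mul_schwartz hs (by simpa using hsn)
      (EuclideanSpace.single i (1 : ℝ)) (EuclideanSpace.single j (1 : ℝ)) (f j) x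
  have hn : 0 < n := by
    simpa using (Module.finrank_pos : 0 < Module.finrank ℝ (EuclideanSpace ℝ (Fin n)))
  have hp := integrable_polar volume (integrable_finsetSum Finset.univ fun j _ => hi j)
  have e : ∀ ξ : sphere (0 : EuclideanSpace ℝ (Fin n)) 1, ∫ t in Set.Ioi (0 : ℝ),
      ((t ^ (Module.finrank ℝ (EuclideanSpace ℝ (Fin n)) - 1) : ℝ) : ℂ) *
        ∑ j, ((‖t • (ξ : EuclideanSpace ℝ (Fin n))‖ ^ (-((n : ℝ) + 2 - 2 * s)) : ℝ) : ℂ) *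
        (⟪EuclideanSpace.single i (1 : ℝ), t • (ξ : EuclideanSpace ℝ (Fin n))⟫ *
          (⟪EuclideanSpace.single j (1 : ℝ), t • (ξ : EuclideanSpace ℝ (Fin n))⟫ *
          f j (x + t • (ξ : EuclideanSpace ℝ (Fin n))))) =
      (((ξ : EuclideanSpace ℝ (Fin n)) i : ℝ) : ℂ) * chi s f x ξ := by
    intro ξ
    rw [chi, ← integral_const_mul]
    refine setIntegral_congr_fun measurableSet_Ioi fun t (ht : 0 < t) => ?_
    simp only [inner_smul_right, inner_single_one, norm_smul, norm_eq_of_mem_sphere, mul_one,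
      Real.norm_of_nonneg ht.le, finrank_euclideanSpace_fin, Finset.mul_sum]
    refine Finset.sum_congr rfl fun j _ => ?_
    have e1 : t ^ (2 * s - 1) = t ^ (n - 1) * t ^ (-((n : ℝ) + 2 - 2 * s)) * t * t := by
      rw [← Real.rpow_natCast, ← Real.rpow_add ht, ← Real.rpow_add_one ht.ne',
        ← Real.rpow_add_one ht.ne', Nat.cast_sub (Nat.one_le_iff_ne_zero.2 hn.ne')]
      push_cast
      ring_nf
    rw [e1]
    push_cast
    ring
  simp only [e] at hp
  refine ⟨hp.1, ?_⟩
  rw [hp.2, integral_finsetSum _ fun j _ => hi j]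

/-- The Fourier transform of the zeroth average. -/
noncomputable def avgZeroSymbol (s : ℝ) (f : Fin n → 𝓢(EuclideanSpace ℝ (Fin n), ℂ))
    (ξ : EuclideanSpace ℝ (Fin n)) : ℂ :=
  ∑ j, -Complex.I * (((2 * Real.pi) ^ (-(2 * s)) : ℝ) : ℂ) *
    symbolOne s (EuclideanSpace.single j (1 : ℝ)) (f j) ξ

theorem integrable_avgZeroSymbol (hs : 0 < s) (hsn : 2 * s < n) :
    Integrable (avgZeroSymbol s f) :=
  integrable_finsetSum _ fun j _ => (integrable_symbolOne hs (by simpa using hsn) _ _).const_mul _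

theorem integrable_norm_mul_avgZeroSymbol (hs : 0 < s) (hsn : 2 * s < n) :
    Integrable fun ξ => ‖ξ‖ * ‖avgZeroSymbol s f ξ‖ := by
  refine (integrable_finsetSum Finset.univ fun j _ => (integrable_norm_mul_symbolOne hs
    (by simpa using hsn) (EuclideanSpace.single j (1 : ℝ)) (f j)).const_mul
      ((2 * Real.pi) ^ (-(2 * s)))).mono'
    (continuous_norm.aestronglyMeasurable.mul (integrable_avgZeroSymbol f hs hsn).1.norm)
    (.of_forall fun ξ => ?_)
  rw [Real.norm_of_nonneg (by positivity)]
  calc _ ≤ ‖ξ‖ * ∑ j, ‖-Complex.I * (((2 * Real.pi) ^ (-(2 * s)) : ℝ) : ℂ) *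
        symbolOne s (EuclideanSpace.single j (1 : ℝ)) (f j) ξ‖ := by
        gcongr
        exact norm_sum_le _ _
    _ = _ := by
        rw [Finset.mul_sum]
        refine Finset.sum_congr rfl fun j _ => ?_
        rw [norm_mul, norm_mul, norm_neg, Complex.norm_I, one_mul, Complex.norm_real,
          Real.norm_of_nonneg (by positivity)]
        ring

theorem avgZero_eq_fourierInv (hs : 0 < s) (hsn : 2 * s < n) :
    avgZero s f = 𝓕⁻ (avgZeroSymbol s f) := by
  ext x
  have hG : ((Real.Gamma (((n : ℝ) + 1 - 2 * s) / 2) *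
      Real.pi ^ (-(((n : ℝ) + 1 - 2 * s) / 2)) : ℝ) : ℂ) ≠ 0 := by
    have := Real.Gamma_pos_of_pos (by linarith : 0 < ((n : ℝ) + 1 - 2 * s) / 2)
    exact Complex.ofReal_ne_zero.2 (by positivity)
  unfold avgZeroSymbol
  rw [avgZero, (integral_sphere_chi f hs hsn x).2, fourierInv_sum_const_mul _ _ fun j =>
    integrable_symbolOne hs (by simpa using hsn) _ _, Finset.mul_sum]
  refine Finset.sum_congr rfl fun j _ => ?_
  have h := integral_inner_kernel_mul_schwartz hs (by simpa using hsn)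
    (EuclideanSpace.single j (1 : ℝ)) (f j) x
  have hc := congrArg (fun r : ℝ => (r : ℂ)) (avgConst_one_zero_mul (n := n) hs)
  simp only [finrank_euclideanSpace_fin] at h
  rw [Complex.ofReal_mul, Complex.ofReal_mul (-_), Complex.ofReal_neg] at hc
  -- After multiplying by the nonzero Gamma factor, the claim combines the kernel formula `h` with
  -- the constant identity `hc`.
  refine mul_left_cancel₀ hG ?_
  linear_combination (avgConst n s 1 0 : ℂ) * h +
    Complex.I * 𝓕⁻ (symbolOne s (EuclideanSpace.single j (1 : ℝ)) (f j)) x * hc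

/-- The kernel has size `|y|^{-(n-2s)}`, and this decay survives integration against Schwartz
functions. It controls the tails of the Riesz integrals. -/
theorem exists_norm_avgZero_le (hs : 0 < s) (hsn : 2 * s < n) :
    ∃ C, 0 ≤ C ∧ ∀ x, ‖avgZero s f x‖ ≤ C * (1 + ‖x‖) ^ (-((n : ℝ) - 2 * s)) := by
  have h : ∀ j, ∃ C, ∀ x, ‖∫ y, ((‖y‖ ^ (-((n : ℝ) + 1 - 2 * s)) : ℝ) : ℂ) *
      (⟪EuclideanSpace.single j (1 : ℝ), y⟫ * f j (x + y))‖ ≤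
        C * (1 + ‖x‖) ^ (-((n : ℝ) - 2 * s)) := by
    intro j
    simp only [← mul_assoc]
    refine exists_norm_integral_kernel_mul_schwartz_le (c := (n : ℝ) - 2 * s)
      (B := ‖EuclideanSpace.single j (1 : ℝ)‖)
      (by linarith) (by rw [finrank_euclideanSpace_fin]; linarith) (fun y => ?_) (f j)
    simpa only [sub_add_eq_add_sub] using
      norm_inner_kernel_le (c := (n : ℝ) - 2 * s) (EuclideanSpace.single j (1 : ℝ)) y
  choose C hC using h
  have key : ∀ x, ‖avgZero s f x‖ ≤
      (|avgConst n s 1 0| * ∑ j, C j) * (1 + ‖x‖) ^ (-((n : ℝ) - 2 * s)) := by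
    intro x
    rw [avgZero, (integral_sphere_chi f hs hsn x).2, norm_mul, Complex.norm_real,
      Real.norm_eq_abs, mul_assoc, Finset.sum_mul]
    gcongr
    exact (norm_sum_le _ _).trans (Finset.sum_le_sum fun j _ => hC j x)
  refine ⟨_, ?_, key⟩
  have := (norm_nonneg _).trans (key 0)
  simpa using this

/-- The `⟪u, v⟫` term of the second order kernel formula is a Kronecker delta here, so only `f i`
survives in the Riesz potential part. -/
theorem avgOne_eq (hs : 0 < s) (hsn : 2 * s < n) (i : Fin n) (x : EuclideanSpace ℝ (Fin n)) :
    avgOne s f i x = (((2 * Real.pi) ^ (-(2 * s)) : ℝ) : ℂ) *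
      (2 * s * ∑ j, 𝓕⁻ (symbolTwo s (EuclideanSpace.single i (1 : ℝ))
        (EuclideanSpace.single j (1 : ℝ)) (f j)) x - 𝓕⁻ (symbolZero s (f i)) x) := by
  have hG : ((Real.Gamma (((n : ℝ) + 2 - 2 * s) / 2) *
      Real.pi ^ (-(((n : ℝ) + 2 - 2 * s) / 2)) : ℝ) : ℂ) ≠ 0 := by
    have := Real.Gamma_pos_of_pos (by linarith : 0 < ((n : ℝ) + 2 - 2 * s) / 2)
    exact Complex.ofReal_ne_zero.2 (by positivity)
  have h : ∀ j, (avgConst n s 1 1 : ℂ) * ∫ y, ((‖y‖ ^ (-((n : ℝ) + 2 - 2 * s)) : ℝ) : ℂ) *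
      (⟪EuclideanSpace.single i (1 : ℝ), y⟫ *
        (⟪EuclideanSpace.single j (1 : ℝ), y⟫ * f j (x + y))) =
      (((2 * Real.pi) ^ (-(2 * s)) : ℝ) : ℂ) * (2 * s * 𝓕⁻ (symbolTwo s
        (EuclideanSpace.single i (1 : ℝ)) (EuclideanSpace.single j (1 : ℝ)) (f j)) x -
        if i = j then 𝓕⁻ (symbolZero s (f j)) x else 0) := by
    intro j
    have h := integral_inner_inner_kernel_mul_schwartz hs (by simpa using hsn)
      (EuclideanSpace.single i (1 : ℝ)) (EuclideanSpace.single j (1 : ℝ)) (f j) x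
    have hc := congrArg (fun r : ℝ => (r : ℂ)) (avgConst_one_one_mul (n := n) hs)
    have hij : (⟪EuclideanSpace.single i (1 : ℝ),
        (EuclideanSpace.single j (1 : ℝ) : EuclideanSpace ℝ (Fin n))⟫ : ℂ) =
        if i = j then 1 else 0 := by
      rw [inner_single_one]
      by_cases hij : i = j <;> simp [hij]
    rw [hij, gamma_add_one_mul_pi_rpow hs] at h
    simp only [finrank_euclideanSpace_fin] at h
    rw [Complex.ofReal_mul, Complex.ofReal_mul (-_), Complex.ofReal_neg] at hc
    refine mul_left_cancel₀ hG ?_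
    set S := 𝓕⁻ (symbolZero s (f j)) x
    set T := 𝓕⁻ (symbolTwo s (EuclideanSpace.single i (1 : ℝ))
      (EuclideanSpace.single j (1 : ℝ)) (f j)) x
    push_cast at h hc ⊢
    split_ifs at h ⊢
    · linear_combination (avgConst n s 1 1 : ℂ) * h + (S - 2 * s * T) * hc
    · linear_combination (avgConst n s 1 1 : ℂ) * h - 2 * s * T * hc
  rw [avgOne, (integral_sphere_mul_chi f hs hsn i x).2, Finset.mul_sum, Finset.sum_congr rfl
    fun j _ => h j, ← Finset.mul_sum, Finset.sum_sub_distrib, ← Finset.mul_sum]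
  simp

end Averages

/-! ### The Riesz transform of the zeroth average. -/

section Riesz

variable {n : ℕ}

theorem rieszIntegrand_eq (i : Fin n) (g : EuclideanSpace ℝ (Fin n) → ℂ)
    (x z : EuclideanSpace ℝ (Fin n)) :
    rieszIntegrand i g x z = ((‖x - z‖ ^ (-((n : ℝ) + 1)) : ℝ) : ℂ) *
      (⟪EuclideanSpace.single i (1 : ℝ), x - z⟫ : ℂ) * g z := by
  rw [rieszIntegrand, inner_single_one, Real.rpow_neg (norm_nonneg _), div_eq_inv_mul,
    Complex.ofReal_mul]
  norm_cast

theorem integrableOn_rieszIntegrand (i : Fin n) {g : EuclideanSpace ℝ (Fin n) → ℂ}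
    (hg : Continuous g) {C δ : ℝ} (hδ : 0 < δ) (hC : 0 ≤ C)
    (hgC : ∀ x, ‖g x‖ ≤ C * (1 + ‖x‖) ^ (-δ)) (x : EuclideanSpace ℝ (Fin n)) {ε : ℝ}
    (hε : 0 < ε) : IntegrableOn (rieszIntegrand i g x) (ball x ε)ᶜ := by
  have h := integrableOn_compl_ball_inner_kernel_mul hg hδ hC hgC
    (EuclideanSpace.single i (1 : ℝ)) x hε
  rw [← integrable_indicator_iff measurableSet_ball.compl] at h ⊢
  refine (h.comp_sub_right x).neg.congr (.of_forall fun z => ?_)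
  simp only [Pi.neg_apply, Set.indicator, Set.mem_compl_iff, mem_ball, dist_eq_norm, sub_zero,
    rieszIntegrand_eq, finrank_euclideanSpace_fin]
  split_ifs
  · simp
  · rw [← neg_sub z x, norm_neg, inner_neg_right, add_sub_cancel]
    push_cast
    ring

theorem rieszTruncated_eq (i : Fin n) (g : EuclideanSpace ℝ (Fin n) → ℂ)
    (x : EuclideanSpace ℝ (Fin n)) (ε : ℝ) :
    rieszTruncated i g x ε = ((Real.Gamma (((n : ℝ) + 1) / 2) *
        Real.pi ^ (-(((n : ℝ) + 1) / 2)) : ℝ) : ℂ) *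
      ∫ y in (ball 0 ε)ᶜ, ((‖y‖ ^ (-((n : ℝ) + 1)) : ℝ) : ℂ) *
        (⟪EuclideanSpace.single i (1 : ℝ), y⟫ : ℂ) * g (x - y) := by
  rw [rieszTruncated, Real.rpow_neg Real.pi_pos.le, ← div_eq_mul_inv,
    ← integral_indicator measurableSet_ball.compl, ← integral_indicator measurableSet_ball.compl,
    ← integral_sub_left_eq_self _ _ x]
  congr 2 with y
  simp only [Set.indicator, Set.mem_compl_iff, mem_ball, dist_eq_norm, sub_zero,
    rieszIntegrand_eq, sub_sub_cancel, sub_sub_cancel_left, norm_neg]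

variable [Nontrivial (EuclideanSpace ℝ (Fin n))] {s : ℝ}
  (f : Fin n → 𝓢(EuclideanSpace ℝ (Fin n), ℂ))

/-- The multiplier `-i ξ_i/|ξ|` meets the factor `-i ξ_j/|ξ|` already in the symbol of the average;
`(-i)² = -1` gives the sign. -/
theorem tendsto_rieszTruncated_avgZero (hs : 0 < s) (hsn : 2 * s < n) (i : Fin n)
    (x : EuclideanSpace ℝ (Fin n)) :
    Tendsto (rieszTruncated i (avgZero s f) x) (𝓝[>] 0)
      (𝓝 (-(((2 * Real.pi) ^ (-(2 * s)) : ℝ) : ℂ) * ∑ j, 𝓕⁻ (symbolTwo s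
        (EuclideanSpace.single i (1 : ℝ)) (EuclideanSpace.single j (1 : ℝ)) (f j)) x)) := by
  obtain ⟨C, hC, hgC⟩ := exists_norm_avgZero_le f hs hsn
  rw [avgZero_eq_fourierInv f hs hsn] at hgC
  have h := tendsto_truncated_riesz (integrable_avgZeroSymbol f hs hsn)
    (integrable_norm_mul_avgZeroSymbol f hs hsn) (by linarith : 0 < (n : ℝ) - 2 * s) hC hgC
    (EuclideanSpace.single i (1 : ℝ)) x
  have e : (fun ξ => ((‖ξ‖ ^ (-1 : ℝ) : ℝ) : ℂ) *
      (⟪EuclideanSpace.single i (1 : ℝ), ξ⟫ * avgZeroSymbol s f ξ)) =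
      fun ξ => ∑ j, -Complex.I * (((2 * Real.pi) ^ (-(2 * s)) : ℝ) : ℂ) * symbolTwo s
        (EuclideanSpace.single i (1 : ℝ)) (EuclideanSpace.single j (1 : ℝ)) (f j) ξ := by
    ext ξ
    simp only [avgZeroSymbol, Finset.mul_sum, symbolOne, symbolTwo]
    refine Finset.sum_congr rfl fun j _ => ?_
    rcases eq_or_ne ξ 0 with rfl | hξ
    · simp
    rw [show -(2 * (s + 1)) = -1 + -(2 * (s + 1 / 2)) by ring,
      Real.rpow_add (norm_pos_iff.2 hξ)]
    push_cast
    ring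
  rw [e, fourierInv_sum_const_mul _ _ fun j =>
    integrable_symbolTwo hs (by simpa using hsn) _ _ _] at h
  rw [avgZero_eq_fourierInv f hs hsn]
  convert h using 2
  · rw [rieszTruncated_eq]
    simp only [finrank_euclideanSpace_fin]
  · rw [← Finset.mul_sum]
    linear_combination (-(((2 * Real.pi) ^ (-(2 * s)) : ℝ) : ℂ) * ∑ j, 𝓕⁻ (symbolTwo s
        (EuclideanSpace.single i (1 : ℝ)) (EuclideanSpace.single j (1 : ℝ)) (f j)) x) *
      Complex.I_sq

theorem rieszConverges_avgZero (hs : 0 < s) (hsn : 2 * s < n) (i : Fin n)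
    (x : EuclideanSpace ℝ (Fin n)) : RieszConverges i (avgZero s f) x := by
  obtain ⟨C, hC, hgC⟩ := exists_norm_avgZero_le f hs hsn
  refine ⟨fun ε hε => integrableOn_rieszIntegrand i ?_ (by linarith : 0 < (n : ℝ) - 2 * s) hC hgC
    x hε, tendsto_nhds_limUnder ⟨_, tendsto_rieszTruncated_avgZero f hs hsn i x⟩⟩
  rw [avgZero_eq_fourierInv f hs hsn]
  exact continuous_fourierInv (integrable_avgZeroSymbol f hs hsn)

theorem rieszTransform_avgZero_eq (hs : 0 < s) (hsn : 2 * s < n) (i : Fin n)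
    (x : EuclideanSpace ℝ (Fin n)) :
    rieszTransform i (avgZero s f) x = -(((2 * Real.pi) ^ (-(2 * s)) : ℝ) : ℂ) *
      ∑ j, 𝓕⁻ (symbolTwo s (EuclideanSpace.single i (1 : ℝ))
        (EuclideanSpace.single j (1 : ℝ)) (f j)) x :=
  (tendsto_rieszTruncated_avgZero f hs hsn i x).limUnder_eq

end Riesz

end DivergentBeam

/-! ### The reconstruction formula. -/

theorem mainTheorem2 (n : ℕ) (hn : 2 ≤ n) (s : ℝ) (hs0 : 0 < s) (hs1 : s < 1) (hs2 : s ≠ 1 / 2)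
    (f : Fin n → 𝓢(EuclideanSpace ℝ (Fin n), ℂ)) :
    -- the integrals that define the transform and its averages converge absolutely
    (∀ (x : EuclideanSpace ℝ (Fin n)) (ξ : sphere (0 : EuclideanSpace ℝ (Fin n)) 1),
      IntegrableOn (fun t : ℝ => ((t ^ (2 * s - 1) : ℝ) : ℂ) *
        ∑ j, f j (x + t • (ξ : EuclideanSpace ℝ (Fin n))) *
          (((ξ : EuclideanSpace ℝ (Fin n)) j : ℝ) : ℂ)) (Set.Ioi 0)) ∧
    (∀ x : EuclideanSpace ℝ (Fin n),
      Integrable (fun ξ : sphere (0 : EuclideanSpace ℝ (Fin n)) 1 => DivergentBeam.chi s f x ξ)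
        (volume : Measure (EuclideanSpace ℝ (Fin n))).toSphere) ∧
    (∀ (i : Fin n) (x : EuclideanSpace ℝ (Fin n)),
      Integrable (fun ξ : sphere (0 : EuclideanSpace ℝ (Fin n)) 1 =>
          (((ξ : EuclideanSpace ℝ (Fin n)) i : ℝ) : ℂ) * DivergentBeam.chi s f x ξ)
        (volume : Measure (EuclideanSpace ℝ (Fin n))).toSphere) ∧
    -- the Riesz transforms of the zeroth average exist
    (∀ (i : Fin n) (x : EuclideanSpace ℝ (Fin n)),
      DivergentBeam.RieszConverges i (DivergentBeam.avgZero s f) x) ∧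
    -- the reconstruction formula
    (∀ i : Fin n, ∃ U : 𝓢'(EuclideanSpace ℝ (Fin n), ℂ),
      DivergentBeam.IsGivenBy U (fun x =>
        -2 * (s : ℂ) * DivergentBeam.rieszTransform i (DivergentBeam.avgZero s f) x
          - DivergentBeam.avgOne s f i x) ∧
      DivergentBeam.IsFracLaplacian s U
        (SchwartzMap.toTemperedDistributionCLM (EuclideanSpace ℝ (Fin n)) ℂ volume (f i))) := by

  have hn' : (2 : ℝ) ≤ n := by exact_mod_cast hn
  have hsn : 2 * s < n := by linarith
  have : Nontrivial (EuclideanSpace ℝ (Fin n)) := by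
    rw [← Module.finrank_pos_iff (R := ℝ), finrank_euclideanSpace_fin]
    omega
  refine ⟨fun x ξ => DivergentBeam.integrableOn_chi f hs0 hs1 x (norm_eq_of_mem_sphere ξ),
    fun x => (DivergentBeam.integral_sphere_chi f hs0 hsn x).1,
    fun i x => (DivergentBeam.integral_sphere_mul_chi f hs0 hsn i x).1,
    DivergentBeam.rieszConverges_avgZero f hs0 hsn, fun i => ?_⟩
  obtain ⟨U, hU, hL⟩ := DivergentBeam.exists_isFracLaplacian hs0 hsn (f i)
  refine ⟨U, ?_, hL⟩
  -- With `U` the Riesz potential of `f i`, only a pointwise identity remains: the `symbolTwo` sums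
  -- from `-2s R_i A^0` and `-A^{1,i}` cancel, leaving `(2π)^{-2s} 𝓕⁻ (symbolZero s (f i))`.
  convert hU using 2 with x
  rw [DivergentBeam.rieszTransform_avgZero_eq f hs0 hsn, DivergentBeam.avgOne_eq f hs0 hsn]
  ring
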